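/- Let $L,d,N\ge 1$, let $d_0,\dots,d_L$ be layer widths with $d_L=2d$, let $\mathcal X\subset\mathbb R^{d_0}$ be bounded, and let $\bm x_1,\dots,\bm x_N$ be i.i.d. samples from a probability distribution $\mathcal D$ on $\mathcal X$. For $\ell=1,\dots,L$ let $\alpha_\ell:\mathbb R^{d_\ell}\to\mathbb R^{d_\ell}$ be $\sigma_\ell$-Lipschitz in the Euclidean norm with $\alpha_\ell(0)=0$, let $\Theta_0^\ell\in\mathbb R^{d_\ell\times d_{\ell-1}}$ be fixed reference matrices, and let $\rho_\ell>0$, $a_\ell\ge 0$. Let $\mathcal F$ be the class of all networks $$f_\Theta(\bm x)=\alpha_L\bigl(\Theta^L\alpha_{L-1}(\Theta^{L-1}\cdots\alpha_1(\Theta^1\bm x))\bigr),\qquad \|\Theta^\ell\|_2\le\rho_\ell,\quad \|(\Theta^\ell-\Theta_0^\ell)^\top\|_{2,1}\le a_\ell\quad(\ell=1,\dots,L),$$ where $\|\cdot\|_2$ of a matrix is the spectral norm and $\|\cdot\|_{2,1}$ is the sum of the Euclidean norms of the columns. Split the output as $f_\Theta(\bm x)=(\mu_\Theta(\bm x),\varepsilon_\Theta(\bm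 x))\in\mathbb R^d\times\mathbb R^d$ and put $$D(f_\Theta;\bm x)=\frac1{2d}\Bigl(\|\mu_\Theta(\bm x)\|_2^2+\|\exp(\varepsilon_\Theta(\bm x))\|_1-d-\langle \bm 1_d,\varepsilon_\Theta(\bm x)\rangle\Bigr),$$ which is $\frac1d$ times the Kullback--Leibler divergence of $\mathcal N(\mu_\Theta(\bm x),\operatorname{diag}(\exp\varepsilon_\Theta(\bm x)))$ from $\mathcal N(0,I_d)$. Let $W=\max_{1\le\ell\le L}d_\ell$, $B_x=\sup_{\bm x\in\mathcal X}\|\bm x\|_2$ and $\eta=1\vee e^{B_x\prod_{\ell=1}^L\rho_\ell\sigma_\ell}$. There are absolute constants $C>0$ and $k\in\mathbb N$, independent of all of the above data, such that for every $\delta\in(0,1)$ the expectations below are finite and, with probability at least $1-\delta$, $$\sup_{f\in\mathcal F}\Bigl[\mathbb E_{\bm x\sim\mathcal D}D(f;\bm x)-\frac1N\sum_{i=1}^N D(f;\bm x_i)\Bigr]\le C\,(1+\log N)^k\,\frac{\eta\,B_x\prod_{\ell=1}^L\rho_\ell\sigma_\ell}{\sqrt N}\Bigl[\sqrt{\log W}\,\Bigl(\sum_{\ell=1}^L(a_\ell/\rho_\ell)^{2/3}\Bigr)^{3/2}\vee\sqrt{\log(1/\delta)}\Bigr].$$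 -/

import Mathlib

open MeasureTheory ProbabilityTheory
open scoped NNReal Matrix

namespace KLGen

/-- The spectral norm of a real matrix: the operator norm with respect to Euclidean norms. -/
noncomputable def spectralNorm {m n : ℕ} (A : Matrix (Fin m) (Fin n) ℝ) : ℝ :=
  ‖LinearMap.toContinuousLinearMap (Matrix.toEuclideanLin A)‖

/-- The `(2,1)`-norm of a real matrix: the sum over the columns of their Euclidean norms. -/
noncomputable def norm21 {m n : ℕ} (A : Matrix (Fin m) (Fin n) ℝ) : ℝ :=
  ∑ j, Real.sqrt (∑ i, A i j ^ 2)

/-- Weights of a depth-`L` network with layer widths `w 0, w 1, …, w L`. The index `ℓ : Fin L`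
stands for the layer from width `w ℓ.castSucc` to width `w ℓ.succ`. -/
abbrev Weights {L : ℕ} (w : Fin (L + 1) → ℕ) : Type :=
  (ℓ : Fin L) → Matrix (Fin (w ℓ.succ)) (Fin (w ℓ.castSucc)) ℝ

/-- Activations, one map `ℝ^{w_ℓ} → ℝ^{w_ℓ}` after each layer. -/
abbrev Activations {L : ℕ} (w : Fin (L + 1) → ℕ) : Type :=
  (ℓ : Fin L) → EuclideanSpace ℝ (Fin (w ℓ.succ)) → EuclideanSpace ℝ (Fin (w ℓ.succ))

/-- The output of the first `ℓ` layers on the input `x`. -/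
noncomputable def layerOutput {L : ℕ} {w : Fin (L + 1) → ℕ} (α : Activations w) (Θ : Weights w)
    (x : EuclideanSpace ℝ (Fin (w 0))) (ℓ : Fin (L + 1)) : EuclideanSpace ℝ (Fin (w ℓ)) :=
  Fin.induction (motive := fun ℓ => EuclideanSpace ℝ (Fin (w ℓ))) x
    (fun ℓ h => α ℓ (Matrix.toEuclideanLin (Θ ℓ) h)) ℓ

/-- The network `x ↦ α_L (Θ^L α_{L-1} (Θ^{L-1} ⋯ α_1 (Θ^1 x)))`. -/
noncomputable def network {L : ℕ} {w : Fin (L + 1) → ℕ} (α : Activations w) (Θ : Weights w)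
    (x : EuclideanSpace ℝ (Fin (w 0))) : EuclideanSpace ℝ (Fin (w (Fin.last L))) :=
  layerOutput α Θ x (Fin.last L)

/-- Weights with spectral norms at most `ρ ℓ` and whose transposed differences to the reference
matrices `Θ₀ ℓ` have `(2,1)`-norms at most `a ℓ`. -/
def weightSet {L : ℕ} {w : Fin (L + 1) → ℕ} (Θ₀ : Weights w) (ρ a : Fin L → ℝ) :
    Set (Weights w) :=
  {Θ | ∀ ℓ, spectralNorm (Θ ℓ) ≤ ρ ℓ ∧ norm21 (Θ ℓ - Θ₀ ℓ)ᵀ ≤ a ℓ}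

/-- The class of the networks with weights in `weightSet Θ₀ ρ a`, as maps on the input set `X`. -/
def encoderClass {L : ℕ} {w : Fin (L + 1) → ℕ} (X : Set (EuclideanSpace ℝ (Fin (w 0))))
    (α : Activations w) (Θ₀ : Weights w) (ρ a : Fin L → ℝ) :
    Set (X → EuclideanSpace ℝ (Fin (w (Fin.last L)))) :=
  {f | ∃ Θ ∈ weightSet Θ₀ ρ a, f = fun x : X => network α Θ x}

/-- The first half `μ` of an encoder output. -/
noncomputable def meanPart {n d : ℕ} (h : n = 2 * d) (v : EuclideanSpace ℝ (Fin n)) :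
    EuclideanSpace ℝ (Fin d) :=
  WithLp.toLp 2 fun j => v ⟨j, by omega⟩

/-- The second half `ε = log σ²` of an encoder output. -/
noncomputable def logVarPart {n d : ℕ} (h : n = 2 * d) (v : EuclideanSpace ℝ (Fin n)) :
    EuclideanSpace ℝ (Fin d) :=
  WithLp.toLp 2 fun j => v ⟨d + j, by omega⟩

/-- The dimension-normalized divergence of `N(μ, diag(exp ε))` from `N(0, I_d)`, namely
`(1/2d) (‖μ‖₂² + ‖exp ε‖₁ - d - ⟨1, ε⟩)`, at the encoder output `v = (μ, ε)`. -/
noncomputable def klReg {n d : ℕ} (h : n = 2 * d) (v : EuclideanSpace ℝ (Fin n)) : ℝ :=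
  1 / (2 * (d : ℝ)) *
    (‖meanPart h v‖ ^ 2 + ∑ j, Real.exp (logVarPart h v j) - d - ∑ j, logVarPart h v j)

/-- `sup_{f ∈ F} [ E_{x ∼ μ} D(f; x) - (1/N) ∑ i, D(f; s i) ]`, as an extended real. -/
noncomputable def genGap {E : Type*} [MeasurableSpace E] {n d N : ℕ} (h : n = 2 * d)
    (F : Set (E → EuclideanSpace ℝ (Fin n))) (μ : Measure E) (s : Fin N → E) : EReal :=
  ⨆ f ∈ F, (((∫ x, klReg h (f x) ∂μ) - 1 / (N : ℝ) * ∑ i, klReg h (f (s i)) : ℝ) : EReal)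

/-- The largest layer width `W = max_{1 ≤ ℓ ≤ L} w_ℓ` (the input width `w 0` is not included). -/
def maxWidth {L : ℕ} (w : Fin (L + 1) → ℕ) : ℕ :=
  Finset.univ.sup fun ℓ : Fin L => w ℓ.succ

/-- `B_x = sup_{x ∈ X} ‖x‖₂` (for nonempty bounded `X`). -/
noncomputable def inputRadius {n : ℕ} (X : Set (EuclideanSpace ℝ (Fin n))) : ℝ :=
  ⨆ x : X, ‖(x : EuclideanSpace ℝ (Fin n))‖

/-- The rate
`(η B_x ∏ ρ_ℓ σ_ℓ / √N) [ √(log W) (∑ (a_ℓ/ρ_ℓ)^{2/3})^{3/2} ∨ √(log (1/δ)) ]`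
with `B = B_x` and `η = 1 ∨ exp (B_x ∏ ρ_ℓ σ_ℓ)`. -/
noncomputable def rate {L : ℕ} (N W : ℕ) (B : ℝ) (ρ a : Fin L → ℝ) (σ : Fin L → ℝ≥0) (δ : ℝ) : ℝ :=
  max 1 (Real.exp (B * ∏ ℓ, ρ ℓ * σ ℓ)) * B * (∏ ℓ, ρ ℓ * σ ℓ) / Real.sqrt N *
    max (Real.sqrt (Real.log W) * (∑ ℓ, (a ℓ / ρ ℓ) ^ (2 / 3 : ℝ)) ^ (3 / 2 : ℝ))
      (Real.sqrt (Real.log (1 / δ)))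

end KLGen

/-! The gap is controlled by the classical route: metric entropy of the class on a sample, Dudley
chaining, symmetrization, McDiarmid.

Entropy. For a fixed batch `V`, the map `M ↦ M V` sends a `(2,1)`-ball into a scaled hull of unit
batches and their negatives, whose number is at most (output width)·n: an orthonormal basis of the
span of the batch replaces the input coordinates (`exists_atoms_applyBatch`). Maurey's method then
covers the ball by sums of few atoms (`exists_sum_atom_close`, `exists_matrix_cover`). Input widths
never enter, hence `W` omits the width of the data. Layer covers are composed inductively; since
spectral norms multiply, relative accuracies add (`exists_batchOutput_cover`). Minimizing the total
entropy `∑ (q_ℓ/t_ℓ)²` under `∑ t_ℓ ≤ τ` produces the exponents 2/3 and 3/2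
(`exists_layer_accuracies`). The entropy at scale `τ` is of order `log(WN)·complexity²/τ²`.

Loss. All outputs lie in a ball of radius `B ∏ ρ_ℓ σ_ℓ`, on which the divergence is Lipschitz with
constant `2 exp` of that radius (`abs_klReg_sub_le`). The normalization by `d` cancels the number of
coordinates. The divergence vanishes at 0, so its range is also proportional to this radius.

Probability. With entropy `τ⁻²` every dyadic scale costs the same, so chaining yields one logarithm
of the sample size (`signAvg_iSup_radSum_le_of_entropy`); splitting `log(WN)` yields the second,
whence `k = 2`. Symmetrization bounds the mean of the supremum and bounded differences bound its
fluctuation (`measureReal_exists_gap_le`). These steps are run for finite families; continuity from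
below and a dense sequence of weights extend them to the whole class. -/

namespace KLGen

/-! ### Rademacher averages, Massart's lemma and Dudley chaining -/

/-- The sign `±1` encoded by a Boolean. -/
def sgn (b : Bool) : ℝ := if b then 1 else -1

/-- The average over all sign vectors of length `n`. -/
noncomputable def signAvg {n : ℕ} (F : (Fin n → Bool) → ℝ) : ℝ := (∑ s, F s) / 2 ^ n

/-- The Rademacher sum `∑ i, ± u i`. -/
noncomputable def radSum {n : ℕ} (s : Fin n → Bool) (u : EuclideanSpace ℝ (Fin n)) : ℝ :=
  ∑ i, sgn (s i) * u i

section signs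

variable {n : ℕ}

lemma signAvg_mono {F G : (Fin n → Bool) → ℝ} (h : ∀ s, F s ≤ G s) : signAvg F ≤ signAvg G := by
  unfold signAvg
  gcongr with s
  exact h s

lemma signAvg_add (F G : (Fin n → Bool) → ℝ) :
    signAvg (fun s => F s + G s) = signAvg F + signAvg G := by
  simp [signAvg, Finset.sum_add_distrib, add_div]

lemma signAvg_const_mul (c : ℝ) (F : (Fin n → Bool) → ℝ) :
    signAvg (fun s => c * F s) = c * signAvg F := by
  simp [signAvg, ← Finset.mul_sum, mul_div_assoc]

lemma signAvg_const (c : ℝ) : signAvg (fun _ : Fin n → Bool => c) = c := by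
  simp [signAvg]

lemma sgn_not (b : Bool) : sgn (!b) = -sgn b := by cases b <;> simp [sgn]

lemma sgn_sq (b : Bool) : sgn b ^ 2 = 1 := by cases b <;> simp [sgn]

lemma signAvg_not (F : (Fin n → Bool) → ℝ) :
    signAvg (fun s => F fun i => !(s i)) = signAvg F := by
  unfold signAvg
  congr 1
  exact Equiv.sum_comp (Equiv.piCongrRight fun _ : Fin n => Equiv.boolNot) F

lemma radSum_add (s : Fin n → Bool) (u v : EuclideanSpace ℝ (Fin n)) :
    radSum s (u + v) = radSum s u + radSum s v := by
  simp [radSum, mul_add, Finset.sum_add_distrib]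

lemma radSum_not (s : Fin n → Bool) (u : EuclideanSpace ℝ (Fin n)) :
    radSum (fun i => !(s i)) u = -radSum s u := by
  simp [radSum, sgn_not]

lemma signAvg_radSum (u : EuclideanSpace ℝ (Fin n)) : signAvg (fun s => radSum s u) = 0 := by
  have h := signAvg_not fun s => radSum s u
  have h2 : signAvg (fun s => radSum (fun i => !(s i)) u) = -signAvg fun s => radSum s u := by
    simp_rw [radSum_not]
    simpa using signAvg_const_mul (-1) fun s => radSum s u
  linarith

lemma radSum_le (s : Fin n → Bool) (u : EuclideanSpace ℝ (Fin n)) :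
    radSum s u ≤ Real.sqrt n * ‖u‖ := by
  have h := Real.sum_mul_le_sqrt_mul_sqrt Finset.univ (fun i => sgn (s i)) (fun i => u i)
  rw [EuclideanSpace.norm_eq]
  simpa [radSum, sgn_sq, sq_abs] using h

/-- The sum over sign vectors factorizes into a product of `2 cosh (t u_i)`, and `cosh x ≤ exp
(x²/2)`. -/
lemma signAvg_exp_radSum_le (u : EuclideanSpace ℝ (Fin n)) (t : ℝ) :
    signAvg (fun s => Real.exp (t * radSum s u)) ≤ Real.exp (t ^ 2 * ‖u‖ ^ 2 / 2) := by
  have h : ∑ s : Fin n → Bool, Real.exp (t * radSum s u) = ∏ i, (2 * Real.cosh (t * u i)) := by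
    have : ∀ i, 2 * Real.cosh (t * u i) = ∑ b : Bool, Real.exp (t * (sgn b * u i)) := by
      intro i
      simp [sgn, Real.cosh_eq]
      ring
    simp_rw [this, Finset.prod_univ_sum, Fintype.piFinset_univ, ← Real.exp_sum, radSum,
      Finset.mul_sum]
  rw [signAvg, h, Finset.prod_mul_distrib, Finset.prod_const, Finset.card_univ, Fintype.card_fin,
    mul_div_cancel_left₀ _ (by positivity), EuclideanSpace.norm_sq_eq, Finset.mul_sum,
    Finset.sum_div, Real.exp_sum]
  refine Finset.prod_le_prod (fun i _ => (Real.cosh_pos _).le) fun i _ => ?_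
  simpa [mul_pow] using Real.cosh_le_exp_half_sq (t * u i)

lemma exp_signAvg_le (F : (Fin n → Bool) → ℝ) :
    Real.exp (signAvg F) ≤ signAvg fun s => Real.exp (F s) := by
  have h := convexOn_exp.map_sum_le (t := Finset.univ) (w := fun _ : Fin n → Bool => (1 / 2 ^ n : ℝ))
    (p := F) (fun _ _ => by positivity) (by simp) (fun _ _ => Set.mem_univ _)
  simpa [signAvg, ← Finset.mul_sum, div_eq_inv_mul] using h

/-- Optimization over the Chernoff parameter. Both `A` and `B` are raised by `e > 0` so that the
minimizer `√(A/B)` exists even if one of them vanishes; then `e → 0`. -/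
lemma le_two_mul_sqrt_of_forall {y A B : ℝ} (hA : 0 ≤ A) (hB : 0 ≤ B)
    (h : ∀ t : ℝ, 0 < t → y ≤ A / t + t * B) : y ≤ 2 * Real.sqrt (A * B) := by
  have key : ∀ e : ℝ, 0 < e → y ≤ 2 * Real.sqrt ((A + e) * (B + e)) := by
    intro e he
    have hA' : 0 < A + e := by linarith
    have hB' : 0 < B + e := by linarith
    have h1 := Real.sqrt_pos.2 hA'
    have h2 := Real.sqrt_pos.2 hB'
    have h3 := h (Real.sqrt (A + e) / Real.sqrt (B + e)) (by positivity)
    have h4 : (A + e) / (Real.sqrt (A + e) / Real.sqrt (B + e)) =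
        Real.sqrt (A + e) * Real.sqrt (B + e) := by
      field_simp
      rw [Real.sq_sqrt hA'.le]
    have h5 : Real.sqrt (A + e) / Real.sqrt (B + e) * (B + e) =
        Real.sqrt (A + e) * Real.sqrt (B + e) := by
      field_simp
      rw [Real.sq_sqrt hB'.le]
    have h6 : A / (Real.sqrt (A + e) / Real.sqrt (B + e)) ≤
        (A + e) / (Real.sqrt (A + e) / Real.sqrt (B + e)) := by
      gcongr
      linarith
    have h7 : Real.sqrt (A + e) / Real.sqrt (B + e) * B ≤
        Real.sqrt (A + e) / Real.sqrt (B + e) * (B + e) := by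
      gcongr
      linarith
    rw [Real.sqrt_mul hA'.le]
    linarith
  have hc : Filter.Tendsto (fun e : ℝ => 2 * Real.sqrt ((A + e) * (B + e)))
      (nhdsWithin 0 (Set.Ioi 0)) (nhds (2 * Real.sqrt ((A + 0) * (B + 0)))) := by
    apply Filter.Tendsto.mono_left _ nhdsWithin_le_nhds
    exact Continuous.tendsto (by fun_prop) 0
  simp only [add_zero] at hc
  exact ge_of_tendsto hc (Filter.eventually_of_mem self_mem_nhdsWithin key)

/-- **Massart's finite class lemma.** -/
lemma signAvg_iSup_radSum_le {T : Type*} [Fintype T] [Nonempty T]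
    [DecidableEq (EuclideanSpace ℝ (Fin n))]
    (u : T → EuclideanSpace ℝ (Fin n)) {r A : ℝ} (hr : ∀ t, ‖u t‖ ≤ r)
    (hA : ((Finset.univ.image u).card : ℝ) ≤ Real.exp A) :
    signAvg (fun s => ⨆ t, radSum s (u t)) ≤ 2 * Real.sqrt (A * (r ^ 2 / 2)) := by
  have hcard : 1 ≤ (Finset.univ.image u).card :=
    Finset.card_pos.2 (Finset.univ_nonempty.image u)
  have hA0 : 0 ≤ A := by
    rw [← Real.one_le_exp_iff]
    exact le_trans (by exact_mod_cast hcard) hA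
  refine le_two_mul_sqrt_of_forall hA0 (by positivity) fun t ht => ?_
  have h1 : Real.exp (t * signAvg fun s => ⨆ i, radSum s (u i)) ≤
      Real.exp (A + t ^ 2 * r ^ 2 / 2) := by
    rw [← signAvg_const_mul]
    refine (exp_signAvg_le _).trans ?_
    calc signAvg (fun s => Real.exp (t * ⨆ i, radSum s (u i)))
        ≤ signAvg (fun s => ∑ v ∈ Finset.univ.image u, Real.exp (t * radSum s v)) := by
          -- The maximum is attained, and its exponential is one term of the sum over the distinct
          -- vectors; repetitions in `T` do not count.
          refine signAvg_mono fun s => ?_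
          obtain ⟨i, hi⟩ := exists_eq_ciSup_of_finite (f := fun i => radSum s (u i))
          rw [← hi]
          exact Finset.single_le_sum (f := fun v => Real.exp (t * radSum s v))
            (fun _ _ => (Real.exp_pos _).le) (Finset.mem_image_of_mem u (Finset.mem_univ i))
      _ = ∑ v ∈ Finset.univ.image u, signAvg (fun s => Real.exp (t * radSum s v)) := by
          simp only [signAvg]
          rw [Finset.sum_comm, Finset.sum_div]
      _ ≤ ∑ v ∈ Finset.univ.image u, Real.exp (t ^ 2 * r ^ 2 / 2) := by
          refine Finset.sum_le_sum fun v hv => (signAvg_exp_radSum_le v t).trans ?_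
          obtain ⟨i, -, rfl⟩ := Finset.mem_image.1 hv
          have := hr i
          gcongr
      _ ≤ Real.exp (A + t ^ 2 * r ^ 2 / 2) := by
          rw [Finset.sum_const, nsmul_eq_mul, Real.exp_add]
          gcongr
  have h2 := Real.exp_le_exp.1 h1
  have h3 : A / t + t * (r ^ 2 / 2) = (A + t ^ 2 * r ^ 2 / 2) / t := by
    field_simp
  rw [h3, le_div_iff₀ ht]
  linarith

lemma iSup_add_le_of_finite {T : Type*} [Finite T] [Nonempty T] (f g : T → ℝ) :
    ⨆ t, (f t + g t) ≤ (⨆ t, f t) + ⨆ t, g t :=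
  ciSup_le fun t => add_le_add (le_ciSup (Set.finite_range f).bddAbove t)
    (le_ciSup (Set.finite_range g).bddAbove t)

/-- One chaining step: passing from one net to another at the cost of the Massart bound for the
increments. -/
lemma signAvg_iSup_radSum_le_add {T : Type*} [Fintype T] [Nonempty T]
    [DecidableEq (EuclideanSpace ℝ (Fin n))]
    (c c' : T → EuclideanSpace ℝ (Fin n)) {r A A' : ℝ} (hr : ∀ t, ‖c' t - c t‖ ≤ r)
    (hA : ((Finset.univ.image c).card : ℝ) ≤ Real.exp A)
    (hA' : ((Finset.univ.image c').card : ℝ) ≤ Real.exp A') :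
    signAvg (fun s => ⨆ t, radSum s (c' t)) ≤
      signAvg (fun s => ⨆ t, radSum s (c t)) + 2 * Real.sqrt ((A + A') * (r ^ 2 / 2)) := by
  have hsub : Finset.univ.image (fun t => c' t - c t) ⊆
      Finset.image (fun p => p.2 - p.1) (Finset.univ.image c ×ˢ Finset.univ.image c') := by
    intro v hv
    obtain ⟨t, -, rfl⟩ := Finset.mem_image.1 hv
    exact Finset.mem_image.2 ⟨(c t, c' t), by simp, rfl⟩
  have hcard : ((Finset.univ.image fun t => c' t - c t).card : ℝ) ≤ Real.exp (A + A') := by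
    have h := (Finset.card_le_card hsub).trans Finset.card_image_le
    rw [Finset.card_product] at h
    calc ((Finset.univ.image fun t => c' t - c t).card : ℝ)
        ≤ ((Finset.univ.image c).card : ℝ) * (Finset.univ.image c').card := by exact_mod_cast h
      _ ≤ _ := by rw [Real.exp_add]; gcongr
  refine le_trans ?_ (add_le_add_right
    (signAvg_iSup_radSum_le (fun t => c' t - c t) hr hcard) _)
  rw [← signAvg_add]
  refine signAvg_mono fun s => le_trans (le_of_eq ?_) (iSup_add_le_of_finite _ _)
  congr 1
  ext t
  rw [← radSum_add, add_sub_cancel]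

lemma natLog_two_add_one_le {n : ℕ} (hn : 1 ≤ n) :
    ((Nat.log 2 n + 1 : ℕ) : ℝ) ≤ 1 + 2 * Real.log n := by
  have h1 : ((2 ^ Nat.log 2 n : ℕ) : ℝ) ≤ n := by
    exact_mod_cast Nat.pow_log_le_self 2 (by omega)
  have h2 := Real.log_le_log (by positivity) h1
  push_cast at h2 ⊢
  rw [Real.log_pow] at h2
  have := Real.log_two_gt_d9
  nlinarith [(Nat.cast_nonneg (Nat.log 2 n) : (0 : ℝ) ≤ _)]

/-- **Dudley's entropy bound** for entropies of order `τ⁻²`, positive constant. -/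
lemma signAvg_iSup_radSum_le_of_pos_entropy {T : Type*} [Fintype T] [Nonempty T]
    [DecidableEq (EuclideanSpace ℝ (Fin n))]
    (hn : 1 ≤ n) (φ : T → EuclideanSpace ℝ (Fin n)) {R K : ℝ} (hR : 0 ≤ R) (hK : 0 < K)
    (h : ∀ τ : ℝ, 0 < τ → ∃ c : T → EuclideanSpace ℝ (Fin n),
      ((Finset.univ.image c).card : ℝ) ≤ Real.exp (K ^ 2 / τ ^ 2) ∧ ∀ t, ‖φ t - c t‖ ≤ R * τ) :
    signAvg (fun s => ⨆ t, radSum s (φ t)) ≤ 14 * R * K * (1 + Real.log n) := by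
  choose! c hc hd using h
  -- Starting at scale `2K` gives entropy 1/4, and `exp (1/4) < 2` forces the coarsest net to be a
  -- single point, whose Rademacher average is zero.
  set τ : ℕ → ℝ := fun j => 2 * K / 2 ^ j with hτ
  have hτ0 : ∀ j, 0 < τ j := fun j => by positivity
  have hent : ∀ j, K ^ 2 / τ j ^ 2 = 4 ^ j / 4 := by
    intro j
    have : (4 : ℝ) ^ j = (2 ^ j) ^ 2 := by rw [← pow_mul, mul_comm, pow_mul]; norm_num
    simp only [hτ, this]
    field_simp
    norm_num
  have hbase : signAvg (fun s => ⨆ t, radSum s (c (τ 0) t)) = 0 := by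
    have h1 : (Finset.univ.image (c (τ 0))).card ≤ 1 := by
      have h2 := hc (τ 0) (hτ0 0)
      rw [hent 0] at h2
      have h3 : Real.exp (4 ^ 0 / 4) < 2 := by
        have h4 := Real.exp_one_lt_d9
        have h5 : Real.exp ((4 : ℝ) ^ 0 / 4) ^ 4 = Real.exp 1 := by
          rw [← Real.exp_nat_mul]; norm_num
        by_contra! h6
        have h7 : (2 : ℝ) ^ 4 ≤ Real.exp ((4 : ℝ) ^ 0 / 4) ^ 4 := by gcongr
        rw [h5] at h7
        norm_num at h7
        linarith
      have h4 : ((Finset.univ.image (c (τ 0))).card : ℝ) < (2 : ℕ) := by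
        exact_mod_cast h2.trans_lt h3
      have := Nat.cast_lt.1 h4
      omega
    obtain ⟨t₀⟩ := ‹Nonempty T›
    have h2 : ∀ t, c (τ 0) t = c (τ 0) t₀ := fun t =>
      Finset.card_le_one.1 h1 _ (Finset.mem_image_of_mem _ (Finset.mem_univ _)) _
        (Finset.mem_image_of_mem _ (Finset.mem_univ _))
    have : Nonempty T := ⟨t₀⟩
    simp_rw [h2, ciSup_const]
    exact signAvg_radSum _
  -- The net sizes grow as fast as the squared increments shrink: the product is `45/8 (RK)² ≤
  -- (3RK)²` at every scale, so each step costs `6RK`.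
  have hstep : ∀ j, signAvg (fun s => ⨆ t, radSum s (c (τ j) t)) ≤ 6 * R * K * j := by
    intro j
    induction j with
    | zero => simpa using hbase.le
    | succ j ih =>
      have hr : ∀ t, ‖c (τ (j + 1)) t - c (τ j) t‖ ≤ R * (6 * K / 2 ^ (j + 1)) := by
        intro t
        have h1 := hd (τ (j + 1)) (hτ0 _) t
        have h2 := hd (τ j) (hτ0 _) t
        rw [norm_sub_rev] at h1
        have h3 := norm_sub_le_norm_sub_add_norm_sub (c (τ (j + 1)) t) (φ t) (c (τ j) t)
        have h4 : R * (6 * K / 2 ^ (j + 1)) = R * τ (j + 1) + R * τ j := by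
          simp only [hτ]
          field_simp
          ring
        linarith
      have h1 := signAvg_iSup_radSum_le_add (c (τ j)) (c (τ (j + 1))) hr (hc _ (hτ0 _))
        (hc _ (hτ0 _))
      rw [hent, hent] at h1
      have h2 : (4 ^ j / 4 + 4 ^ (j + 1) / 4) * ((R * (6 * K / 2 ^ (j + 1))) ^ 2 / 2) ≤
          (3 * R * K) ^ 2 := by
        have : (4 : ℝ) ^ j = (2 ^ j) ^ 2 := by rw [← pow_mul, mul_comm, pow_mul]; norm_num
        rw [pow_succ (4 : ℝ), pow_succ (2 : ℝ), this]
        have h3 : ((2 : ℝ) ^ j) ≠ 0 := by positivity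
        have h4 : ((2 ^ j) ^ 2 / 4 + (2 ^ j) ^ 2 * 4 / 4) *
            ((R * (6 * K / (2 ^ j * 2))) ^ 2 / 2) = 45 / 8 * (R * K) ^ 2 := by
          field_simp
          ring
        rw [h4]
        nlinarith [sq_nonneg (R * K)]
      have h3 := Real.sqrt_le_sqrt h2
      rw [Real.sqrt_sq (by positivity)] at h3
      push_cast
      linarith
  -- With this depth `2 ^ m ≥ n ≥ √n`, so the crude Cauchy-Schwarz bound on the remainder is at most
  -- `2RK`.
  set m := Nat.log 2 n + 1 with hm
  have hmn : Real.sqrt n / 2 ^ m ≤ 1 := by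
    rw [div_le_one (by positivity)]
    have h1 : (n : ℝ) ≤ 2 ^ m := by
      exact_mod_cast (Nat.lt_pow_succ_log_self (by norm_num) n).le
    have h2 : (1 : ℝ) ≤ n := by exact_mod_cast hn
    refine le_trans ?_ h1
    rw [Real.sqrt_le_left (by linarith)]
    nlinarith
  have hlast : signAvg (fun s => ⨆ t, radSum s (φ t)) ≤
      signAvg (fun s => ⨆ t, radSum s (c (τ m) t)) + 2 * R * K := by
    rw [← signAvg_const (n := n) (2 * R * K), ← signAvg_add]
    refine signAvg_mono fun s => ciSup_le fun t => ?_
    have h1 : radSum s (φ t) = radSum s (c (τ m) t) + radSum s (φ t - c (τ m) t) := by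
      rw [← radSum_add, add_sub_cancel]
    rw [h1]
    refine add_le_add (le_ciSup (f := fun t => radSum s (c (τ m) t))
      (Set.finite_range _).bddAbove t) ?_
    calc radSum s (φ t - c (τ m) t) ≤ Real.sqrt n * ‖φ t - c (τ m) t‖ := radSum_le _ _
      _ ≤ Real.sqrt n * (R * τ m) := by
          gcongr
          exact hd _ (hτ0 _) t
      _ = Real.sqrt n / 2 ^ m * (2 * R * K) := by
          simp only [hτ]
          ring
      _ ≤ 1 * (2 * R * K) := by gcongr
      _ = 2 * R * K := one_mul _
  have h1 := hstep m
  have h2 := natLog_two_add_one_le hn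
  have h3 : 6 * R * K * m ≤ 6 * R * K * (1 + 2 * Real.log n) := by gcongr
  have h4 : 0 ≤ R * K := by positivity
  have h5 : 0 ≤ R * K * Real.log n := mul_nonneg h4 (Real.log_natCast_nonneg n)
  linarith

/-- **Dudley's entropy bound** for entropies of order `τ⁻²`. -/
theorem signAvg_iSup_radSum_le_of_entropy {T : Type*} [Fintype T] [Nonempty T]
    [DecidableEq (EuclideanSpace ℝ (Fin n))]
    (hn : 1 ≤ n) (φ : T → EuclideanSpace ℝ (Fin n)) {R K : ℝ} (hR : 0 ≤ R) (hK : 0 ≤ K)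
    (h : ∀ τ : ℝ, 0 < τ → ∃ c : T → EuclideanSpace ℝ (Fin n),
      ((Finset.univ.image c).card : ℝ) ≤ Real.exp (K ^ 2 / τ ^ 2) ∧ ∀ t, ‖φ t - c t‖ ≤ R * τ) :
    signAvg (fun s => ⨆ t, radSum s (φ t)) ≤ 14 * R * K * (1 + Real.log n) := by
  have hc : Filter.Tendsto (fun e : ℝ => 14 * R * (K + e) * (1 + Real.log n))
      (nhdsWithin 0 (Set.Ioi 0)) (nhds (14 * R * (K + 0) * (1 + Real.log n))) := by
    apply Filter.Tendsto.mono_left _ nhdsWithin_le_nhds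
    exact Continuous.tendsto (by fun_prop) 0
  simp only [add_zero] at hc
  refine ge_of_tendsto hc (Filter.eventually_of_mem self_mem_nhdsWithin fun e he => ?_)
  have he : 0 < e := he
  refine signAvg_iSup_radSum_le_of_pos_entropy hn φ hR (by linarith) fun τ hτ => ?_
  obtain ⟨c, hc, hd⟩ := h τ hτ
  refine ⟨c, hc.trans ?_, hd⟩
  gcongr
  linarith

end signs

/-! ### Maurey's empirical method -/

section maurey

variable {E : Type*} [NormedAddCommGroup E] [InnerProductSpace ℝ E] {ι : Type*}

/-- The atoms `0` and `± c z i`. -/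
noncomputable def atom (c : ℝ) (z : ι → E) : Option (ι × Bool) → E
  | none => 0
  | some (i, b) => (c * sgn b) • z i

lemma norm_atom_le {c : ℝ} (hc : 0 ≤ c) {z : ι → E} (hz : ∀ i, ‖z i‖ ≤ 1)
    (o : Option (ι × Bool)) : ‖atom c z o‖ ≤ c := by
  rcases o with _ | ⟨i, b⟩
  · simpa [atom] using hc
  · have h : |sgn b| = 1 := by cases b <;> simp [sgn]
    rw [atom, norm_smul, Real.norm_eq_abs, abs_mul, h, mul_one, abs_of_nonneg hc]
    exact mul_le_of_le_one_right hc (hz i)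

lemma norm_sum_smul_le [Fintype ι] {c : ℝ} {z : ι → E} (hz : ∀ i, ‖z i‖ ≤ 1) {β : ι → ℝ}
    (hβ : ∑ i, |β i| ≤ c) : ‖∑ i, β i • z i‖ ≤ c := by
  refine (norm_sum_le _ _).trans (le_trans (Finset.sum_le_sum fun i _ => ?_) hβ)
  rw [norm_smul, Real.norm_eq_abs]
  exact mul_le_of_le_one_right (abs_nonneg _) (hz i)

/-- A linear functional on the hull of the atoms is minimized at an atom: take the `z i` with the
largest absolute inner product, with the opposing sign. -/
lemma exists_inner_atom_le [Fintype ι] {c : ℝ} (z : ι → E) {β : ι → ℝ}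
    (hβ : ∑ i, |β i| ≤ c) (s : E) :
    ∃ o, inner ℝ s (atom c z o) ≤ inner ℝ s (∑ i, β i • z i) := by
  rcases isEmpty_or_nonempty ι with h | h
  · exact ⟨none, by simp [atom]⟩
  · obtain ⟨i, hi⟩ := Finite.exists_max fun i => |inner ℝ s (z i)|
    have h1 : -(c * |inner ℝ s (z i)|) ≤ inner ℝ s (∑ i, β i • z i) := by
      rw [inner_sum]
      calc -(c * |inner ℝ s (z i)|) ≤ -∑ j, |β j| * |inner ℝ s (z i)| := by
            rw [← Finset.sum_mul]
            gcongr
        _ ≤ -∑ j, |β j| * |inner ℝ s (z j)| := by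
            refine neg_le_neg (Finset.sum_le_sum fun j _ => ?_)
            exact mul_le_mul_of_nonneg_left (hi j) (abs_nonneg _)
        _ ≤ ∑ j, inner ℝ s (β j • z j) := by
            rw [← Finset.sum_neg_distrib]
            refine Finset.sum_le_sum fun j _ => ?_
            rw [inner_smul_right, ← abs_mul]
            exact neg_abs_le _
    rcases le_total 0 (inner ℝ s (z i)) with h2 | h2
    · refine ⟨some (i, false), le_trans (le_of_eq ?_) h1⟩
      rw [abs_of_nonneg h2]
      simp [atom, sgn, inner_smul_right]
    · refine ⟨some (i, true), le_trans (le_of_eq ?_) h1⟩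
      rw [abs_of_nonpos h2]
      simp [atom, sgn, inner_smul_right]

/-- **Maurey's empirical method**, greedy form. -/
lemma exists_sum_atom_close [Fintype ι] {c : ℝ} {z : ι → E} (hz : ∀ i, ‖z i‖ ≤ 1)
    {β : ι → ℝ} (hβ : ∑ i, |β i| ≤ c) (k : ℕ) :
    ∃ f : Fin k → Option (ι × Bool),
      ‖∑ t, atom c z (f t) - (k : ℝ) • ∑ i, β i • z i‖ ^ 2 ≤ 4 * c ^ 2 * k := by
  have hc : 0 ≤ c := (Finset.sum_nonneg fun i _ => abs_nonneg (β i)).trans hβ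
  induction k with
  | zero => exact ⟨Fin.elim0, by simp⟩
  | succ k ih =>
    obtain ⟨f, hf⟩ := ih
    set y := ∑ i, β i • z i
    set s := ∑ t, atom c z (f t) - (k : ℝ) • y
    -- This choice makes the cross term `⟨s, atom - y⟩` nonpositive, so the squared error grows by
    -- at most `(2c)²`; no randomness is needed.
    obtain ⟨o, ho⟩ := exists_inner_atom_le z hβ s
    refine ⟨Fin.cons o f, ?_⟩
    have h1 : ∑ t, atom c z ((Fin.cons o f : Fin (k + 1) → _) t) - ((k + 1 : ℕ) : ℝ) • y =
        s + (atom c z o - y) := by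
      rw [Fin.sum_univ_succ]
      simp only [Fin.cons_zero, Fin.cons_succ, s]
      push_cast
      rw [add_smul, one_smul]
      abel
    have h2 : ‖atom c z o - y‖ ≤ 2 * c := by
      refine (norm_sub_le _ _).trans ?_
      linarith [norm_atom_le hc hz o, norm_sum_smul_le hz hβ]
    have h3 : ‖atom c z o - y‖ ^ 2 ≤ (2 * c) ^ 2 := by gcongr
    rw [h1, norm_add_sq_real, inner_sub_right]
    push_cast
    linarith

end maurey

/-! ### Matrices acting on a batch, and covers of `(2,1)`-balls -/

/-- `n` vectors in `ℝ^q` with the Frobenius norm. -/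
abbrev Batch (n q : ℕ) : Type := PiLp 2 fun _ : Fin n => EuclideanSpace ℝ (Fin q)

lemma norm_piLp_le_mul {n : ℕ} {β γ : Fin n → Type*} [∀ i, SeminormedAddCommGroup (β i)]
    [∀ i, SeminormedAddCommGroup (γ i)] {U : PiLp 2 β} {V : PiLp 2 γ} {c : ℝ} (hc : 0 ≤ c)
    (h : ∀ i, ‖U i‖ ≤ c * ‖V i‖) : ‖U‖ ≤ c * ‖V‖ := by
  rw [PiLp.norm_eq_of_L2, PiLp.norm_eq_of_L2, ← Real.sqrt_sq hc, ← Real.sqrt_mul (sq_nonneg c),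
    Finset.mul_sum]
  refine Real.sqrt_le_sqrt (Finset.sum_le_sum fun i _ => ?_)
  rw [← mul_pow]
  exact pow_le_pow_left₀ (norm_nonneg _) (h i) 2

/-- A matrix applied to every vector of a batch. -/
noncomputable def applyBatch {n p q : ℕ} (A : Matrix (Fin q) (Fin p) ℝ) (V : Batch n p) :
    Batch n q :=
  WithLp.toLp 2 fun i => Matrix.toEuclideanLin A (V i)

@[simp] lemma applyBatch_apply {n p q : ℕ} (A : Matrix (Fin q) (Fin p) ℝ) (V : Batch n p)
    (i : Fin n) : applyBatch A V i = Matrix.toEuclideanLin A (V i) := rfl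

lemma applyBatch_sub {n p q : ℕ} (A B : Matrix (Fin q) (Fin p) ℝ) (V : Batch n p) :
    applyBatch (A - B) V = applyBatch A V - applyBatch B V := by
  ext i : 1
  simp

lemma applyBatch_sub_right {n p q : ℕ} (A : Matrix (Fin q) (Fin p) ℝ) (V V' : Batch n p) :
    applyBatch A (V - V') = applyBatch A V - applyBatch A V' := by
  ext i : 1
  simp

lemma norm_toEuclideanLin_le {p q : ℕ} (A : Matrix (Fin q) (Fin p) ℝ)
    (v : EuclideanSpace ℝ (Fin p)) : ‖Matrix.toEuclideanLin A v‖ ≤ spectralNorm A * ‖v‖ :=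
  (LinearMap.toContinuousLinearMap (Matrix.toEuclideanLin A)).le_opNorm v

lemma spectralNorm_nonneg {p q : ℕ} (A : Matrix (Fin q) (Fin p) ℝ) : 0 ≤ spectralNorm A :=
  norm_nonneg _

lemma norm_applyBatch_le {n p q : ℕ} (A : Matrix (Fin q) (Fin p) ℝ) (V : Batch n p) :
    ‖applyBatch A V‖ ≤ spectralNorm A * ‖V‖ :=
  norm_piLp_le_mul (spectralNorm_nonneg A) fun i => norm_toEuclideanLin_le A (V i)

/-- Products of matrices with a fixed batch are short combinations of unit batches, the number of
which does not depend on the input dimension. -/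
lemma exists_atoms_applyBatch {n p : ℕ} (q : ℕ) (V : Batch n p) :
    ∃ r ≤ n, ∃ z : Fin q × Fin r → Batch n q, (∀ i, ‖z i‖ ≤ 1) ∧
      ∀ M : Matrix (Fin q) (Fin p) ℝ, ∃ β : Fin q × Fin r → ℝ,
        ∑ i, |β i| ≤ norm21 Mᵀ * ‖V‖ ∧ applyBatch M V = ∑ i, β i • z i := by
  set S : Submodule ℝ (EuclideanSpace ℝ (Fin p)) := Submodule.span ℝ (Set.range fun i => V i)
    with hS
  have hVS : ∀ i, V i ∈ S := fun i => Submodule.subset_span ⟨i, rfl⟩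
  set e := stdOrthonormalBasis ℝ S
  set u : Fin (Module.finrank ℝ S) → EuclideanSpace ℝ (Fin p) := fun j => (e j : _) with hu
  have hue : Orthonormal ℝ u := e.orthonormal.comp_linearIsometry S.subtypeₗᵢ
  have hV : ∀ i, V i = ∑ j, inner ℝ (u j) (V i) • u j := by
    intro i
    have h := congrArg (Subtype.val) (e.sum_repr' ⟨V i, hVS i⟩)
    simpa [hu] using h.symm
  have hbessel : ∀ v : EuclideanSpace ℝ (Fin p), ∑ j, inner ℝ (u j) v ^ 2 ≤ ‖v‖ ^ 2 := by
    intro v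
    simpa [sq_abs] using hue.sum_inner_products_le v (s := Finset.univ)
  -- `ν j` is the length of the `j`-th coordinate row of the batch. It normalizes the atoms,
  -- division by zero giving the zero atom, and is put back into the coefficients `β`.
  set ν : Fin (Module.finrank ℝ S) → ℝ := fun j => Real.sqrt (∑ i, inner ℝ (u j) (V i) ^ 2) with hν
  have hν2 : ∀ j, ν j ^ 2 = ∑ i, inner ℝ (u j) (V i) ^ 2 := fun j =>
    Real.sq_sqrt (Finset.sum_nonneg fun _ _ => sq_nonneg _)
  have hν0 : ∀ j, 0 ≤ ν j := fun j => Real.sqrt_nonneg _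
  refine ⟨Module.finrank ℝ S, (finrank_range_le_card fun i => V i).trans_eq (Fintype.card_fin n),
    fun k => WithLp.toLp 2 fun i => (inner ℝ (u k.2) (V i) / ν k.2) • EuclideanSpace.single k.1 1,
    ?_, ?_⟩
  · rintro ⟨k, j⟩
    rw [PiLp.norm_eq_of_L2, Real.sqrt_le_one]
    simp only [norm_smul, PiLp.norm_single, norm_one, mul_one, Real.norm_eq_abs, sq_abs,
      div_pow]
    rw [← Finset.sum_div, ← hν2]
    exact div_self_le_one _
  · intro M
    refine ⟨fun k => inner ℝ (u k.2) (WithLp.toLp 2 (M k.1)) * ν k.2, ?_, ?_⟩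
    -- Row by row: Cauchy-Schwarz in `j`, then Bessel for the row of `M` and for the vectors of the
    -- batch.
    · rw [Fintype.sum_prod_type, norm21, Finset.sum_mul]
      refine Finset.sum_le_sum fun k _ => ?_
      simp only [abs_mul, abs_of_nonneg (hν0 _)]
      refine (Real.sum_mul_le_sqrt_mul_sqrt _ _ _).trans ?_
      gcongr
      · have h := hbessel (WithLp.toLp 2 (M k))
        rw [EuclideanSpace.real_norm_sq_eq] at h
        simpa [sq_abs] using h
      · rw [PiLp.norm_eq_of_L2]
        refine Real.sqrt_le_sqrt ?_
        simp_rw [hν2]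
        rw [Finset.sum_comm]
        exact Finset.sum_le_sum fun i _ => hbessel (V i)
    · ext i k
      have h1 : Matrix.toEuclideanLin M (V i) k = inner ℝ (V i) (WithLp.toLp 2 (M k)) := by
        simp [Matrix.toLpLin_apply, Matrix.mulVec, dotProduct, PiLp.inner_apply]
      have h2 : ∀ j, inner ℝ (u j) (WithLp.toLp 2 (M k)) * ν j * (inner ℝ (u j) (V i) / ν j) =
          inner ℝ (u j) (V i) * inner ℝ (u j) (WithLp.toLp 2 (M k)) := by
        intro j
        rcases eq_or_ne (ν j) 0 with h | h
        · have h3 := hν2 j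
          rw [h, eq_comm] at h3
          have h4 := (Finset.sum_eq_zero_iff_of_nonneg fun i _ => sq_nonneg _).1
            (h3.trans (by norm_num)) i (Finset.mem_univ _)
          rw [pow_eq_zero_iff two_ne_zero] at h4
          simp [h4]
        · field_simp
      rw [applyBatch_apply, h1]
      nth_rewrite 1 [hV i]
      rw [sum_inner]
      simp only [inner_smul_left, RCLike.conj_to_real, ← h2]
      rw [Fintype.sum_prod_type]
      simp [Pi.single_apply]

/-- One representative in `s` for each code that occurs. This makes the covers proper, so that norm
constraints survive for their elements. -/
lemma exists_finset_representatives {γ ι : Type*} [Fintype ι] (s : Set γ) (f : γ → ι) :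
    ∃ t : Finset γ, ↑t ⊆ s ∧ t.card ≤ Fintype.card ι ∧ ∀ a ∈ s, ∃ a' ∈ t, f a' = f a := by
  obtain ⟨t, hts, ht⟩ := Set.exists_subset_bijOn s f
  have hfin : t.Finite := Set.Finite.of_finite_image (Set.toFinite _) ht.injOn
  refine ⟨hfin.toFinset, by simpa using hts, ?_, fun a ha => ?_⟩
  · refine Finset.card_le_card_of_injOn f (fun _ _ => Finset.mem_univ _) ?_
    simpa using ht.injOn
  · obtain ⟨a', ha', h⟩ := ht.surjOn (Set.mem_image_of_mem f ha)
    exact ⟨a', by simpa using ha', h⟩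

/-- A proper cover of a `(2,1)`-ball of matrices, as operators on a fixed batch. -/
lemma exists_matrix_cover {n p q : ℕ} (V : Batch n p) {b : ℝ} (hV : ‖V‖ ≤ b)
    (A₀ : Matrix (Fin q) (Fin p) ℝ) {a κ : ℝ} (ha : 0 ≤ a) (hκ : 0 ≤ κ) (hκa : κ = 0 → a = 0)
    (s : Set (Matrix (Fin q) (Fin p) ℝ)) (hs : ∀ A ∈ s, norm21 (A - A₀)ᵀ ≤ a) :
    ∃ t : Finset (Matrix (Fin q) (Fin p) ℝ), ↑t ⊆ s ∧
      t.card ≤ (2 * (q * n) + 1) ^ ⌊32 * (a / κ) ^ 2⌋₊ ∧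
      ∀ A ∈ s, ∃ A' ∈ t, ‖applyBatch A V - applyBatch A' V‖ ≤ b * κ := by
  obtain ⟨r, hr, z, hz, hz'⟩ := exists_atoms_applyBatch q V
  set k := ⌊32 * (a / κ) ^ 2⌋₊ with hk
  have hb : 0 ≤ b := (norm_nonneg _).trans hV
  have hrep : ∀ A : Matrix (Fin q) (Fin p) ℝ, ∃ f : Fin k → Option ((Fin q × Fin r) × Bool),
      A ∈ s → ‖∑ t, atom (a * b) z (f t) - (k : ℝ) • applyBatch (A - A₀) V‖ ^ 2 ≤
        4 * (a * b) ^ 2 * k ∧ ‖applyBatch (A - A₀) V‖ ≤ a * b := by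
    intro A
    by_cases hA : A ∈ s
    · obtain ⟨β, hβ, h⟩ := hz' (A - A₀)
      have hβ' : ∑ i, |β i| ≤ a * b := by
        refine hβ.trans ?_
        have := hs A hA
        gcongr
      obtain ⟨f, hf⟩ := exists_sum_atom_close hz hβ' k
      exact ⟨f, fun _ => ⟨by rw [h]; exact hf, by rw [h]; exact norm_sum_smul_le hz hβ'⟩⟩
    · exact ⟨fun _ => none, fun h => absurd h hA⟩
  choose f hf using hrep
  obtain ⟨t, hts, htc, ht⟩ := exists_finset_representatives s f
  refine ⟨t, hts, htc.trans ?_, fun A hA => ?_⟩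
  · simp only [Fintype.card_fun, Fintype.card_option, Fintype.card_prod, Fintype.card_fin,
      Fintype.card_bool]
    refine Nat.pow_le_pow_left ?_ k
    have : q * r ≤ q * n := Nat.mul_le_mul_left q hr
    omega
  · obtain ⟨A', hA', h⟩ := ht A hA
    refine ⟨A', hA', ?_⟩
    obtain ⟨h1, h2⟩ := hf A hA
    obtain ⟨h3, h4⟩ := hf A' (hts hA')
    -- `A` and `A'` have the same code, so both scaled products are within `2ab√k` of one common sum
    -- of atoms.
    rw [h] at h3
    set y := applyBatch (A - A₀) V
    set y' := applyBatch (A' - A₀) V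
    have hyy : applyBatch A V - applyBatch A' V = y - y' := by
      simp only [y, y', applyBatch_sub]
      abel
    rw [hyy]
    have htriv : ‖y - y'‖ ≤ 2 * (a * b) := (norm_sub_le _ _).trans (by linarith)
    rcases hκ.eq_or_lt with h0 | hκ
    · rw [hκa h0.symm] at htriv
      rw [← h0]
      simpa using htriv
    have hroot : ∀ x : ℝ, 0 ≤ x → x ^ 2 ≤ 4 * (a * b) ^ 2 * k → x ≤ 2 * (a * b) * Real.sqrt k := by
      intro x hx h
      refine abs_le_of_sq_le_sq' ?_ (by positivity) |>.2
      rw [mul_pow, mul_pow, Real.sq_sqrt (Nat.cast_nonneg k)]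
      linarith
    have h5 := hroot _ (norm_nonneg _) h1
    have h6 := hroot _ (norm_nonneg _) h3
    have h7 : (k : ℝ) * ‖y - y'‖ ≤ 4 * (a * b) * Real.sqrt k := by
      have h8 : (k : ℝ) * ‖y - y'‖ = ‖(k : ℝ) • y - (k : ℝ) • y'‖ := by
        rw [← smul_sub, norm_smul, Real.norm_natCast]
      rw [h8]
      rw [norm_sub_rev] at h5
      have := norm_sub_le_norm_sub_add_norm_sub ((k : ℝ) • y) (∑ t, atom (a * b) z (f A t))
        ((k : ℝ) • y')
      linarith
    -- If `k = 0`, then `2a ≤ κ` and the trivial bound `2ab` suffices. Otherwise `32 (a/κ)² < k + 1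
    -- ≤ 2k`, hence `4a ≤ κ√k`; this is why the constant is 32.
    rcases Nat.eq_zero_or_pos k with hk0 | hk0
    · have h8 : 32 * (a / κ) ^ 2 < 1 := Nat.floor_eq_zero.1 (hk ▸ hk0)
      have h9 : 2 * (a / κ) ≤ 1 := by
        by_contra! h
        nlinarith
      have h10 : 2 * a ≤ κ := by
        rw [← mul_div_assoc, div_le_one hκ] at h9
        exact h9
      nlinarith
    · have hk1 : (1 : ℝ) ≤ k := by exact_mod_cast hk0
      have h8 : 32 * (a / κ) ^ 2 ≤ 2 * k := by
        have := Nat.lt_floor_add_one (32 * (a / κ) ^ 2)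
        rw [← hk] at this
        linarith
      have hsk := Real.sqrt_pos.2 (lt_of_lt_of_le one_pos hk1)
      have h9 : 4 * (a / κ) ≤ Real.sqrt k := by
        refine Real.le_sqrt_of_sq_le ?_
        nlinarith
      have h10 : 4 * a ≤ κ * Real.sqrt k := by
        rw [← mul_div_assoc, div_le_iff₀ hκ] at h9
        linarith
      have h11 : (k : ℝ) * ‖y - y'‖ ≤ k * (b * κ) := by
        calc (k : ℝ) * ‖y - y'‖ ≤ 4 * (a * b) * Real.sqrt k := h7
          _ = (4 * a) * (b * Real.sqrt k) := by ring
          _ ≤ (κ * Real.sqrt k) * (b * Real.sqrt k) := by gcongr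
          _ = (Real.sqrt k * Real.sqrt k) * (b * κ) := by ring
          _ = k * (b * κ) := by rw [Real.mul_self_sqrt (by linarith)]
      exact le_of_mul_le_mul_left h11 (by linarith)

/-! ### Entropy of the network class on a batch -/

section network

variable {L : ℕ} {w : Fin (L + 1) → ℕ}

@[simp] lemma layerOutput_zero (α : Activations w) (Θ : Weights w)
    (x : EuclideanSpace ℝ (Fin (w 0))) : layerOutput α Θ x 0 = x := rfl

@[simp] lemma layerOutput_succ (α : Activations w) (Θ : Weights w)
    (x : EuclideanSpace ℝ (Fin (w 0))) (ℓ : Fin L) :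
    layerOutput α Θ x ℓ.succ =
      α ℓ (Matrix.toEuclideanLin (Θ ℓ) (layerOutput α Θ x ℓ.castSucc)) := rfl

lemma layerOutput_congr (α : Activations w) {Θ Θ' : Weights w}
    (x : EuclideanSpace ℝ (Fin (w 0))) (ℓ : Fin (L + 1))
    (h : ∀ j : Fin L, j.castSucc < ℓ → Θ j = Θ' j) :
    layerOutput α Θ x ℓ = layerOutput α Θ' x ℓ := by
  induction ℓ using Fin.induction with
  | zero => rfl
  | succ ℓ ih =>
    rw [layerOutput_succ, layerOutput_succ, h ℓ Fin.castSucc_lt_succ,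
      ih fun j hj => h j (hj.trans Fin.castSucc_lt_succ)]

/-- The layers below the index `ℓ`. -/
def below (ℓ : Fin (L + 1)) : Finset (Fin L) := Finset.univ.filter fun j => j.castSucc < ℓ

@[simp] lemma below_zero : below (0 : Fin (L + 1)) = ∅ := by
  simp [below]

@[simp] lemma below_last : below (Fin.last L) = Finset.univ := by
  simp [below, Fin.castSucc_lt_last]

lemma notMem_below_castSucc (ℓ : Fin L) : ℓ ∉ below ℓ.castSucc := by
  simp [below]

lemma below_succ (ℓ : Fin L) : below ℓ.succ = insert ℓ (below ℓ.castSucc) := by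
  ext j
  simp only [below, Finset.mem_filter, Finset.mem_univ, true_and, Finset.mem_insert, Fin.lt_def,
    Fin.val_castSucc, Fin.val_succ, Fin.ext_iff]
  omega

lemma prod_below_succ (f : Fin L → ℝ) (ℓ : Fin L) :
    ∏ j ∈ below ℓ.succ, f j = f ℓ * ∏ j ∈ below ℓ.castSucc, f j := by
  rw [below_succ, Finset.prod_insert (notMem_below_castSucc ℓ)]

lemma sum_below_succ {M : Type*} [AddCommMonoid M] (f : Fin L → M) (ℓ : Fin L) :
    ∑ j ∈ below ℓ.succ, f j = f ℓ + ∑ j ∈ below ℓ.castSucc, f j := by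
  rw [below_succ, Finset.sum_insert (notMem_below_castSucc ℓ)]

variable {α : Activations w} {σ : Fin L → ℝ≥0} {Θ₀ : Weights w} {ρ a : Fin L → ℝ}

lemma norm_layerOutput_le (hα : ∀ ℓ, LipschitzWith (σ ℓ) (α ℓ)) (hα0 : ∀ ℓ, α ℓ 0 = 0)
    (hρ : ∀ ℓ, 0 < ρ ℓ) {Θ : Weights w} (hΘ : Θ ∈ weightSet Θ₀ ρ a)
    (x : EuclideanSpace ℝ (Fin (w 0))) (ℓ : Fin (L + 1)) :
    ‖layerOutput α Θ x ℓ‖ ≤ (∏ j ∈ below ℓ, ρ j * σ j) * ‖x‖ := by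
  induction ℓ using Fin.induction with
  | zero => simp
  | succ ℓ ih =>
    rw [layerOutput_succ, prod_below_succ]
    have h1 := (hα ℓ).norm_sub_le (Matrix.toEuclideanLin (Θ ℓ) (layerOutput α Θ x ℓ.castSucc)) 0
    rw [hα0, sub_zero, sub_zero] at h1
    have h2 := norm_toEuclideanLin_le (Θ ℓ) (layerOutput α Θ x ℓ.castSucc)
    calc _ ≤ σ ℓ * (ρ ℓ * ((∏ j ∈ below ℓ.castSucc, ρ j * σ j) * ‖x‖)) := by
          refine h1.trans ?_
          gcongr
          refine h2.trans ?_
          have := (hΘ ℓ).1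
          have := (hρ ℓ).le
          gcongr
      _ = _ := by ring

/-- The outputs of the first layers on a batch of inputs. -/
noncomputable def batchOutput {n : ℕ} (α : Activations w) (Θ : Weights w)
    (x : Batch n (w 0)) (ℓ : Fin (L + 1)) : Batch n (w ℓ) :=
  WithLp.toLp 2 fun i => layerOutput α Θ (x i) ℓ

@[simp] lemma batchOutput_apply {n : ℕ} (Θ : Weights w) (x : Batch n (w 0))
    (ℓ : Fin (L + 1)) (i : Fin n) : batchOutput α Θ x ℓ i = layerOutput α Θ (x i) ℓ := rfl

lemma prod_mul_nonneg (hρ : ∀ ℓ, 0 < ρ ℓ) (s : Finset (Fin L)) : 0 ≤ ∏ j ∈ s, ρ j * σ j :=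
  Finset.prod_nonneg fun j _ => mul_nonneg (hρ j).le (σ j).2

lemma norm_batchOutput_le {n : ℕ} (hα : ∀ ℓ, LipschitzWith (σ ℓ) (α ℓ)) (hα0 : ∀ ℓ, α ℓ 0 = 0)
    (hρ : ∀ ℓ, 0 < ρ ℓ) {Θ : Weights w} (hΘ : Θ ∈ weightSet Θ₀ ρ a)
    (x : Batch n (w 0)) (ℓ : Fin (L + 1)) :
    ‖batchOutput α Θ x ℓ‖ ≤ (∏ j ∈ below ℓ, ρ j * σ j) * ‖x‖ :=
  norm_piLp_le_mul (prod_mul_nonneg hρ _) fun i => norm_layerOutput_le hα hα0 hρ hΘ (x i) ℓ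

lemma width_le_maxWidth (w : Fin (L + 1) → ℕ) (ℓ : Fin L) : w ℓ.succ ≤ maxWidth w :=
  Finset.le_sup (f := fun ℓ : Fin L => w ℓ.succ) (Finset.mem_univ ℓ)

lemma layerOutput_update (α : Activations w) (Θ : Weights w)
    (x : EuclideanSpace ℝ (Fin (w 0))) (ℓ : Fin L)
    (A : Matrix (Fin (w ℓ.succ)) (Fin (w ℓ.castSucc)) ℝ) :
    layerOutput α (Function.update Θ ℓ A) x ℓ.castSucc = layerOutput α Θ x ℓ.castSucc := by
  apply layerOutput_congr
  intro j hj
  have hne : j ≠ ℓ := by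
    rintro rfl
    exact lt_irrefl _ hj
  exact Function.update_of_ne hne A Θ

/-- The error splits as `Θ V - A V' = Θ (V - V') + (Θ V' - A V')`. The matrices are compared only on
the approximate batch `V'`, for which a finite cover can be prepared. -/
lemma norm_batchOutput_succ_sub_update_le {n : ℕ} (hα : ∀ ℓ, LipschitzWith (σ ℓ) (α ℓ))
    (x : Batch n (w 0)) (ℓ : Fin L) (Θ Θ' : Weights w)
    (A : Matrix (Fin (w ℓ.succ)) (Fin (w ℓ.castSucc)) ℝ) :
    ‖batchOutput α Θ x ℓ.succ - batchOutput α (Function.update Θ' ℓ A) x ℓ.succ‖ ≤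
      σ ℓ * (spectralNorm (Θ ℓ) *
          ‖batchOutput α Θ x ℓ.castSucc - batchOutput α Θ' x ℓ.castSucc‖ +
        ‖applyBatch (Θ ℓ) (batchOutput α Θ' x ℓ.castSucc) -
          applyBatch A (batchOutput α Θ' x ℓ.castSucc)‖) := by
  set V := batchOutput α Θ x ℓ.castSucc with hV
  set V' := batchOutput α Θ' x ℓ.castSucc with hV'
  have h1 : ‖batchOutput α Θ x ℓ.succ - batchOutput α (Function.update Θ' ℓ A) x ℓ.succ‖ ≤
      σ ℓ * ‖applyBatch (Θ ℓ) V - applyBatch A V'‖ := by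
    refine norm_piLp_le_mul (σ ℓ).2 fun i => ?_
    simp only [PiLp.sub_apply, batchOutput_apply, layerOutput_succ, applyBatch_apply, hV, hV',
      Function.update_self, layerOutput_update]
    exact (hα ℓ).norm_sub_le _ _
  have h3 : applyBatch (Θ ℓ) V - applyBatch A V' =
      applyBatch (Θ ℓ) (V - V') + (applyBatch (Θ ℓ) V' - applyBatch A V') := by
    rw [applyBatch_sub_right]
    abel
  refine h1.trans (mul_le_mul_of_nonneg_left ?_ (σ ℓ).2)
  rw [h3]
  exact (norm_add_le _ _).trans (add_le_add_left (norm_applyBatch_le _ _) _)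

/-- A proper cover of the network class on a batch: relative accuracies `τ j` of the layers add
up. -/
lemma exists_batchOutput_cover {n : ℕ} (hα : ∀ ℓ, LipschitzWith (σ ℓ) (α ℓ))
    (hα0 : ∀ ℓ, α ℓ 0 = 0) (hρ : ∀ ℓ, 0 < ρ ℓ) (ha : ∀ ℓ, 0 ≤ a ℓ) {τ : Fin L → ℝ}
    (hτ : ∀ ℓ, 0 ≤ τ ℓ) (hτa : ∀ ℓ, τ ℓ = 0 → a ℓ = 0) (x : Batch n (w 0)) (ℓ : Fin (L + 1)) :
    ∃ t : Finset (Weights w), ↑t ⊆ weightSet Θ₀ ρ a ∧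
      t.card ≤ (2 * (maxWidth w * n) + 1) ^ ∑ j ∈ below ℓ, ⌊32 * (a j / ρ j / τ j) ^ 2⌋₊ ∧
      ∀ Θ ∈ weightSet Θ₀ ρ a, ∃ Θ' ∈ t, ‖batchOutput α Θ x ℓ - batchOutput α Θ' x ℓ‖ ≤
        (∏ j ∈ below ℓ, ρ j * σ j) * ‖x‖ * ∑ j ∈ below ℓ, τ j := by
  classical
  induction ℓ using Fin.induction with
  | zero =>
    rcases (weightSet Θ₀ ρ a).eq_empty_or_nonempty with h | ⟨Θ', hΘ'⟩
    · exact ⟨∅, by simp, by simp, by simp [h]⟩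
    · refine ⟨{Θ'}, by simpa using hΘ', by simp, fun Θ _ => ⟨Θ', by simp, ?_⟩⟩
      have h : batchOutput α Θ x 0 = batchOutput α Θ' x 0 := by
        ext i : 1
        simp
      simp [h]
  | succ ℓ ih =>
    obtain ⟨t, hts, htc, ht⟩ := ih
    set P := ∏ j ∈ below ℓ.castSucc, ρ j * (σ j : ℝ)
    have hP : 0 ≤ P := prod_mul_nonneg hρ _
    have hb : ∀ Θ ∈ weightSet Θ₀ ρ a, ‖batchOutput α Θ x ℓ.castSucc‖ ≤ P * ‖x‖ := fun Θ hΘ =>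
      norm_batchOutput_le hα hα0 hρ hΘ x _
    -- The cover of layer `ℓ` depends on `Θ` through the batch entering that layer. Its accuracy `ρ
    -- ℓ * τ ℓ` is chosen so that both error terms get the same prefactor and the `τ j` add.
    have hcov : ∀ Θ : Weights w, ∃ u : Finset (Matrix (Fin (w ℓ.succ)) (Fin (w ℓ.castSucc)) ℝ),
        Θ ∈ weightSet Θ₀ ρ a →
          ↑u ⊆ {A | spectralNorm A ≤ ρ ℓ ∧ norm21 (A - Θ₀ ℓ)ᵀ ≤ a ℓ} ∧
          u.card ≤ (2 * (maxWidth w * n) + 1) ^ ⌊32 * (a ℓ / ρ ℓ / τ ℓ) ^ 2⌋₊ ∧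
          ∀ A ∈ {A | spectralNorm A ≤ ρ ℓ ∧ norm21 (A - Θ₀ ℓ)ᵀ ≤ a ℓ}, ∃ A' ∈ u,
            ‖applyBatch A (batchOutput α Θ x ℓ.castSucc) -
              applyBatch A' (batchOutput α Θ x ℓ.castSucc)‖ ≤ P * ‖x‖ * (ρ ℓ * τ ℓ) := by
      intro Θ
      by_cases hΘ : Θ ∈ weightSet Θ₀ ρ a
      · obtain ⟨u, hu1, hu2, hu3⟩ := exists_matrix_cover (batchOutput α Θ x ℓ.castSucc) (hb Θ hΘ)
          (Θ₀ ℓ) (ha ℓ) (mul_nonneg (hρ ℓ).le (hτ ℓ))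
          (fun h => hτa ℓ ((mul_eq_zero.1 h).resolve_left (hρ ℓ).ne'))
          {A | spectralNorm A ≤ ρ ℓ ∧ norm21 (A - Θ₀ ℓ)ᵀ ≤ a ℓ} (fun A hA => hA.2)
        refine ⟨u, fun _ => ⟨hu1, ?_, hu3⟩⟩
        rw [div_div]
        refine hu2.trans (Nat.pow_le_pow_left ?_ _)
        have := Nat.mul_le_mul_right n (width_le_maxWidth w ℓ)
        omega
      · exact ⟨∅, fun h => absurd h hΘ⟩
    choose u hu using hcov
    refine ⟨t.biUnion fun Θ => (u Θ).image fun A => Function.update Θ ℓ A, ?_, ?_, ?_⟩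
    · intro Θ hΘ
      simp only [Finset.coe_biUnion, Set.mem_iUnion, Finset.coe_image, Set.mem_image] at hΘ
      obtain ⟨Θ', hΘ', A, hA, rfl⟩ := hΘ
      intro j
      rcases eq_or_ne j ℓ with rfl | hj
      · simpa using (hu Θ' (hts hΘ')).1 hA
      · rw [Function.update_of_ne hj]
        exact hts hΘ' j
    · rw [sum_below_succ, pow_add, mul_comm]
      refine (Finset.card_biUnion_le_card_mul _ _ _ fun Θ hΘ => ?_).trans
        (Nat.mul_le_mul_right _ htc)
      exact Finset.card_image_le.trans (hu Θ (hts hΘ)).2.1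
    · intro Θ hΘ
      obtain ⟨Θ', hΘ', hd⟩ := ht Θ hΘ
      obtain ⟨A', hA', hdA⟩ := (hu Θ' (hts hΘ')).2.2 (Θ ℓ) (hΘ ℓ)
      refine ⟨Function.update Θ' ℓ A',
        Finset.mem_biUnion.2 ⟨Θ', hΘ', Finset.mem_image_of_mem _ hA'⟩, ?_⟩
      have h1 := norm_batchOutput_succ_sub_update_le hα x ℓ Θ Θ' A'
      have h2 : spectralNorm (Θ ℓ) * ‖batchOutput α Θ x ℓ.castSucc - batchOutput α Θ' x ℓ.castSucc‖
          ≤ ρ ℓ * (P * ‖x‖ * ∑ j ∈ below ℓ.castSucc, τ j) :=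
        mul_le_mul (hΘ ℓ).1 hd (norm_nonneg _) (hρ ℓ).le
      rw [prod_below_succ, sum_below_succ]
      have hσ : (0 : ℝ) ≤ σ ℓ := (σ ℓ).2
      calc _ ≤ σ ℓ * (ρ ℓ * (P * ‖x‖ * ∑ j ∈ below ℓ.castSucc, τ j) +
            P * ‖x‖ * (ρ ℓ * τ ℓ)) := by
            exact h1.trans (mul_le_mul_of_nonneg_left (add_le_add h2 hdA) hσ)
        _ = _ := by ring

/-- The norm-based complexity `(∑ (a_ℓ/ρ_ℓ)^{2/3})^{3/2}`. -/
noncomputable def complexity (ρ a : Fin L → ℝ) : ℝ :=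
  (∑ ℓ, (a ℓ / ρ ℓ) ^ (2 / 3 : ℝ)) ^ (3 / 2 : ℝ)

/-- The optimal distribution of an accuracy among the layers. -/
lemma exists_layer_accuracies (hρ : ∀ ℓ, 0 < ρ ℓ) (ha : ∀ ℓ, 0 ≤ a ℓ) {τ : ℝ} (hτ : 0 < τ) :
    ∃ t : Fin L → ℝ, (∀ ℓ, 0 ≤ t ℓ) ∧ (∀ ℓ, t ℓ = 0 → a ℓ = 0) ∧ ∑ ℓ, t ℓ ≤ τ ∧
      ∑ ℓ, (a ℓ / ρ ℓ / t ℓ) ^ 2 ≤ complexity ρ a ^ 2 / τ ^ 2 := by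
  set q : Fin L → ℝ := fun ℓ => a ℓ / ρ ℓ with hq
  have hq0 : ∀ ℓ, 0 ≤ q ℓ := fun ℓ => div_nonneg (ha ℓ) (hρ ℓ).le
  have hc0 : ∀ ℓ, 0 ≤ q ℓ ^ (2 / 3 : ℝ) := fun ℓ => Real.rpow_nonneg (hq0 ℓ) _
  set S := ∑ ℓ, q ℓ ^ (2 / 3 : ℝ) with hS
  have hS0 : 0 ≤ S := Finset.sum_nonneg fun ℓ _ => hc0 ℓ
  have hcube : ∀ ℓ, q ℓ ^ 2 = (q ℓ ^ (2 / 3 : ℝ)) ^ 3 := by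
    intro ℓ
    rw [← Real.rpow_natCast, ← Real.rpow_natCast, ← Real.rpow_mul (hq0 ℓ)]
    norm_num
  have hcomp : complexity ρ a ^ 2 = S ^ 3 := by
    change (S ^ (3 / 2 : ℝ)) ^ 2 = S ^ 3
    rw [← Real.rpow_natCast, ← Real.rpow_natCast, ← Real.rpow_mul hS0]
    norm_num
  rw [hcomp]
  -- If `S = 0` every `a ℓ` vanishes and accuracy zero is affordable; otherwise `t ℓ` is taken
  -- proportional to `q ℓ ^ (2/3)`, the Lagrange minimizer.
  rcases hS0.eq_or_lt with h0 | hS1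
  · have hqz : ∀ ℓ, q ℓ = 0 := by
      intro ℓ
      have h1 := (Finset.sum_eq_zero_iff_of_nonneg fun ℓ _ => hc0 ℓ).1 h0.symm ℓ (Finset.mem_univ _)
      have h2 := hcube ℓ
      rw [h1] at h2
      simpa using h2
    refine ⟨0, fun _ => le_rfl, fun ℓ _ => ?_, by simpa using hτ.le, by simp [← h0]⟩
    have := hqz ℓ
    simpa [hq, (hρ ℓ).ne'] using this
  · refine ⟨fun ℓ => τ * q ℓ ^ (2 / 3 : ℝ) / S, fun ℓ => by have := hc0 ℓ; positivity, ?_, ?_, ?_⟩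
    · intro ℓ h
      have h1 : q ℓ ^ (2 / 3 : ℝ) = 0 := by
        simpa [hτ.ne', hS1.ne'] using h
      have h2 := hcube ℓ
      rw [h1] at h2
      have h3 : q ℓ = 0 := by simpa using h2
      simpa [hq, (hρ ℓ).ne'] using h3
    · rw [← Finset.sum_div, ← Finset.mul_sum, ← hS, mul_div_assoc, div_self hS1.ne', mul_one]
    · refine le_of_eq ?_
      calc ∑ ℓ, (q ℓ / (τ * q ℓ ^ (2 / 3 : ℝ) / S)) ^ 2
          = ∑ ℓ, S ^ 2 / τ ^ 2 * q ℓ ^ (2 / 3 : ℝ) := by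
            refine Finset.sum_congr rfl fun ℓ _ => ?_
            rw [div_pow, hcube]
            rcases eq_or_ne (q ℓ ^ (2 / 3 : ℝ)) 0 with h | h
            · simp [h]
            · field_simp
        _ = S ^ 3 / τ ^ 2 := by
            rw [← Finset.mul_sum, ← hS]
            ring

/-- The metric entropy of the network class on a batch of inputs. -/
theorem exists_network_cover {n : ℕ} (hα : ∀ ℓ, LipschitzWith (σ ℓ) (α ℓ))
    (hα0 : ∀ ℓ, α ℓ 0 = 0) (hρ : ∀ ℓ, 0 < ρ ℓ) (ha : ∀ ℓ, 0 ≤ a ℓ) {τ : ℝ} (hτ : 0 < τ)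
    (x : Batch n (w 0)) :
    ∃ t : Finset (Weights w), ↑t ⊆ weightSet Θ₀ ρ a ∧
      (t.card : ℝ) ≤ Real.exp (32 * Real.log (2 * (maxWidth w * n) + 1) *
        complexity ρ a ^ 2 / τ ^ 2) ∧
      ∀ Θ ∈ weightSet Θ₀ ρ a, ∃ Θ' ∈ t,
        ‖batchOutput α Θ x (Fin.last L) - batchOutput α Θ' x (Fin.last L)‖ ≤
          (∏ ℓ, ρ ℓ * σ ℓ) * ‖x‖ * τ := by
  obtain ⟨r, hr0, hra, hrs, hrq⟩ := exists_layer_accuracies hρ ha hτ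
  obtain ⟨t, hts, htc, ht⟩ := exists_batchOutput_cover (Θ₀ := Θ₀) hα hα0 hρ ha hr0 hra x
    (Fin.last L)
  rw [below_last] at htc
  simp only [below_last] at ht
  refine ⟨t, hts, ?_, fun Θ hΘ => ?_⟩
  · set m := ∑ j, ⌊32 * (a j / ρ j / r j) ^ 2⌋₊
    have hm : (m : ℝ) ≤ 32 * (complexity ρ a ^ 2 / τ ^ 2) := by
      calc (m : ℝ) ≤ ∑ j, 32 * (a j / ρ j / r j) ^ 2 := by
            simp only [m, Nat.cast_sum]
            exact Finset.sum_le_sum fun j _ => Nat.floor_le (by positivity)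
        _ ≤ _ := by
            rw [← Finset.mul_sum]
            linarith
    have hbase : (0 : ℝ) < 2 * (maxWidth w * n) + 1 := by positivity
    have hlog : 0 ≤ Real.log (2 * (maxWidth w * n) + 1) :=
      Real.log_nonneg (le_add_of_nonneg_left (by positivity))
    calc (t.card : ℝ) ≤ (2 * (maxWidth w * n) + 1 : ℝ) ^ m := by exact_mod_cast htc
      _ = Real.exp (m * Real.log (2 * (maxWidth w * n) + 1)) := by
          rw [Real.exp_nat_mul, Real.exp_log hbase]
      _ ≤ _ := by
          refine Real.exp_le_exp.2 ((mul_le_mul_of_nonneg_right hm hlog).trans (le_of_eq ?_))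
          ring
  · obtain ⟨Θ', hΘ', h⟩ := ht Θ hΘ
    refine ⟨Θ', hΘ', h.trans ?_⟩
    have := prod_mul_nonneg (σ := σ) hρ Finset.univ
    gcongr

end network

/-! ### Hoeffding's lemma and McDiarmid's inequality -/

section concentration

variable {E : Type*} [MeasurableSpace E] (μ : Measure E) [IsProbabilityMeasure μ]

lemma integrable_of_measurable_of_abs_le {Ω : Type*} [MeasurableSpace Ω] {ν : Measure Ω}
    [IsFiniteMeasure ν] {f : Ω → ℝ} (hf : Measurable f) {C : ℝ} (h : ∀ x, |f x| ≤ C) :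
    Integrable f ν :=
  Integrable.of_bound hf.aestronglyMeasurable C (Filter.Eventually.of_forall h)

lemma integrable_exp_of_abs_le {Ω : Type*} [MeasurableSpace Ω] {ν : Measure Ω}
    [IsFiniteMeasure ν] {f : Ω → ℝ} (hf : Measurable f) {C : ℝ} (h : ∀ x, |f x| ≤ C) :
    Integrable (fun x => Real.exp (f x)) ν :=
  integrable_of_measurable_of_abs_le (Real.measurable_exp.comp hf) (C := Real.exp C) fun x => by
    rw [Real.abs_exp]
    exact Real.exp_le_exp.2 (abs_le.1 (h x)).2

lemma abs_integral_le_of_abs_le {Ω : Type*} [MeasurableSpace Ω] {ν : Measure Ω}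
    [IsProbabilityMeasure ν] {f : Ω → ℝ} {C : ℝ} (h : ∀ x, |f x| ≤ C) : |∫ x, f x ∂ν| ≤ C := by
  have h' : ∀ᵐ x ∂ν, ‖f x‖ ≤ C := Filter.Eventually.of_forall h
  simpa using norm_integral_le_of_norm_le_const h'

/-- Hoeffding's lemma for a function of oscillation at most `c`. -/
lemma integral_exp_sub_integral_le {f : E → ℝ} (hf : Measurable f) {c : ℝ}
    (hc : ∀ x y, f x - f y ≤ c) (t : ℝ) :
    ∫ x, Real.exp (t * (f x - ∫ y, f y ∂μ)) ∂μ ≤ Real.exp (c ^ 2 * t ^ 2 / 8) := by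
  have hne : Nonempty E := μ.nonempty_of_neZero
  have hbdd : BddBelow (Set.range f) := by
    obtain ⟨x⟩ := hne
    refine ⟨f x - c, ?_⟩
    rintro _ ⟨y, rfl⟩
    linarith [hc x y]
  have hIcc : ∀ x, f x ∈ Set.Icc (⨅ y, f y) ((⨅ y, f y) + c) := by
    intro x
    refine ⟨ciInf_le hbdd x, ?_⟩
    have : f x - c ≤ ⨅ y, f y := le_ciInf fun y => by linarith [hc x y]
    linarith
  have h := (hasSubgaussianMGF_of_mem_Icc (μ := μ) hf.aemeasurable
    (Filter.Eventually.of_forall hIcc)).mgf_le t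
  refine h.trans (le_of_eq ?_)
  congr 1
  simp only [add_sub_cancel_left]
  push_cast
  rw [Real.norm_eq_abs, div_pow, sq_abs]
  ring

/-- **McDiarmid's inequality**, moment generating function form. -/
theorem integral_exp_sub_integral_pi_le (n : ℕ) {H : (Fin n → E) → ℝ} (hH : Measurable H)
    {C : ℝ} (hC : ∀ x, |H x| ≤ C) {c : ℝ}
    (hc : ∀ x i e, H x - H (Function.update x i e) ≤ c) (t : ℝ) :
    ∫ x, Real.exp (t * (H x - ∫ y, H y ∂(Measure.pi fun _ => μ))) ∂(Measure.pi fun _ => μ) ≤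
      Real.exp (n * c ^ 2 * t ^ 2 / 8) := by
  induction n with
  | zero =>
    have h : ∀ x, H x = H default := fun x => congrArg H (Subsingleton.elim _ _)
    simp_rw [h]
    simp
  | succ n ih =>
    set π : Measure (Fin n → E) := Measure.pi fun _ => μ with hπ
    have hmp := (measurePreserving_piFinSuccAbove (fun _ : Fin (n + 1) => μ) 0).symm
    have hcons : ∀ p : E × (Fin n → E),
        (MeasurableEquiv.piFinSuccAbove (fun _ : Fin (n + 1) => E) 0).symm p =
          (Fin.cons p.1 p.2 : Fin (n + 1) → E) := by
      intro p
      simp [MeasurableEquiv.piFinSuccAbove_symm_apply, Fin.insertNthEquiv]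
    have hint : ∀ F : (Fin (n + 1) → E) → ℝ, ∫ x, F x ∂(Measure.pi fun _ => μ) =
        ∫ p : E × (Fin n → E), F (Fin.cons p.1 p.2) ∂(μ.prod π) := by
      intro F
      rw [← hmp.integral_comp' (g := F)]
      simp_rw [hcons]
      rfl
    have hmc : Measurable fun p : E × (Fin n → E) => (Fin.cons p.1 p.2 : Fin (n + 1) → E) := by
      have h := (MeasurableEquiv.piFinSuccAbove (fun _ : Fin (n + 1) => E) 0).symm.measurable
      convert h using 1
      ext1 p
      exact (hcons p).symm
    have hK : Measurable fun p : E × (Fin n → E) => H (Fin.cons p.1 p.2) := hH.comp hmc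
    have hKy : ∀ y : Fin n → E, Measurable fun e => H (Fin.cons e y) := fun y =>
      hK.comp measurable_prodMk_right
    -- Averaging out the first coordinate preserves bounded differences. Hoeffding's lemma controls
    -- `H - H'` for each fixed tail, and the induction hypothesis controls `H'`.
    set H' : (Fin n → E) → ℝ := fun y => ∫ e, H (Fin.cons e y) ∂μ with hH'
    have hH'm : Measurable H' := hK.stronglyMeasurable.integral_prod_left'.measurable
    have hH'C : ∀ y, |H' y| ≤ C := fun y => abs_integral_le_of_abs_le fun e => hC _
    have hKint : ∀ y : Fin n → E, Integrable (fun e => H (Fin.cons e y)) μ := fun y =>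
      integrable_of_measurable_of_abs_le (hKy y) fun e => hC _
    have hH'c : ∀ y i e, H' y - H' (Function.update y i e) ≤ c := by
      intro y i e
      simp only [hH']
      rw [← integral_sub (hKint _) (hKint _)]
      refine (integral_mono ((hKint _).sub (hKint _)) (integrable_const c) fun e' => ?_).trans_eq
        (by simp)
      have h := hc (Fin.cons e' y) i.succ e
      rwa [← Fin.cons_update] at h
    have hmean : ∫ x, H x ∂(Measure.pi fun _ => μ) = ∫ y, H' y ∂π := by
      rw [hint, integral_prod_symm _ (integrable_of_measurable_of_abs_le hK fun p => hC _)]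
    rw [hint, hmean]
    set m := ∫ y, H' y ∂π
    have hb : ∀ p : E × (Fin n → E), |t * (H (Fin.cons p.1 p.2) - m)| ≤ |t| * (C + C) := by
      intro p
      rw [abs_mul]
      refine mul_le_mul_of_nonneg_left ?_ (abs_nonneg t)
      exact (abs_sub _ _).trans (add_le_add (hC _) (abs_integral_le_of_abs_le hH'C))
    have hb' : ∀ y, |t * (H' y - m)| ≤ |t| * (C + C) := by
      intro y
      rw [abs_mul]
      refine mul_le_mul_of_nonneg_left ?_ (abs_nonneg t)
      exact (abs_sub _ _).trans (add_le_add (hH'C _) (abs_integral_le_of_abs_le hH'C))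
    have hexp := integrable_exp_of_abs_le (ν := μ.prod π) ((hK.sub_const m).const_mul t) hb
    rw [integral_prod_symm _ hexp]
    calc ∫ y, ∫ e, Real.exp (t * (H (Fin.cons e y) - m)) ∂μ ∂π
        ≤ ∫ y, Real.exp (t * (H' y - m)) * Real.exp (c ^ 2 * t ^ 2 / 8) ∂π := by
          refine integral_mono hexp.integral_prod_right
            ((integrable_exp_of_abs_le ((hH'm.sub_const m).const_mul t) hb').mul_const _)
            fun y => ?_
          have h1 : ∀ e, Real.exp (t * (H (Fin.cons e y) - m)) =
              Real.exp (t * (H' y - m)) * Real.exp (t * (H (Fin.cons e y) - H' y)) := by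
            intro e
            rw [← Real.exp_add]
            ring_nf
          simp only [h1]
          rw [integral_const_mul]
          refine mul_le_mul_of_nonneg_left ?_ (Real.exp_pos _).le
          refine integral_exp_sub_integral_le μ (hKy y) (fun e e' => ?_) t
          have h := hc (Fin.cons e y) 0 e'
          rwa [Fin.update_cons_zero] at h
      _ ≤ Real.exp (n * c ^ 2 * t ^ 2 / 8) * Real.exp (c ^ 2 * t ^ 2 / 8) := by
          rw [integral_mul_const]
          exact mul_le_mul_of_nonneg_right (ih hH'm hH'C hH'c) (Real.exp_pos _).le
      _ = _ := by
          rw [← Real.exp_add]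
          congr 1
          push_cast
          ring

lemma hasSubgaussianMGF_pi (n : ℕ) {H : (Fin n → E) → ℝ} (hH : Measurable H)
    {C : ℝ} (hC : ∀ x, |H x| ≤ C) {c : ℝ}
    (hc : ∀ x i e, H x - H (Function.update x i e) ≤ c) :
    HasSubgaussianMGF (fun x => H x - ∫ y, H y ∂(Measure.pi fun _ => μ))
      (Real.toNNReal (n * c ^ 2 / 4)) (Measure.pi fun _ => μ) where
  integrable_exp_mul t := by
    refine integrable_exp_of_abs_le ((hH.sub_const _).const_mul t) (C := |t| * (C + C)) fun x => ?_
    rw [abs_mul]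
    refine mul_le_mul_of_nonneg_left ?_ (abs_nonneg t)
    exact (abs_sub _ _).trans (add_le_add (hC _) (abs_integral_le_of_abs_le hC))
  mgf_le t := by
    refine (integral_exp_sub_integral_pi_le μ n hH hC hc t).trans (le_of_eq ?_)
    rw [Real.coe_toNNReal _ (by positivity)]
    congr 1
    ring

lemma measureReal_sqrt_lt_le {Ω : Type*} [MeasurableSpace Ω] {P : Measure Ω}
    [IsProbabilityMeasure P] {Z : Ω → ℝ} {c : ℝ≥0} (h : HasSubgaussianMGF Z c P) {δ : ℝ}
    (hδ : 0 < δ) (hδ1 : δ < 1) :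
    P.real {ω | Real.sqrt (2 * c * Real.log (1 / δ)) < Z ω} ≤ δ := by
  have hlog : 0 ≤ Real.log (1 / δ) := Real.log_nonneg (by rw [le_div_iff₀ hδ]; linarith)
  -- With parameter zero the Chernoff exponent is a division by zero; there `Z = 0` almost surely
  -- and the strict inequality defines a null event.
  rcases eq_or_ne c 0 with rfl | hc
  · have h0 := h.ae_eq_zero_of_hasSubgaussianMGF_zero
    have h1 : P {ω | Real.sqrt (2 * (0 : ℝ≥0) * Real.log (1 / δ)) < Z ω} = 0 := by
      refine measure_mono_null (fun ω hω => ?_) (ae_iff.1 h0)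
      have hω : Real.sqrt (2 * (0 : ℝ≥0) * Real.log (1 / δ)) < Z ω := hω
      simp at hω
      exact hω.ne'
    rw [measureReal_def, h1]
    simpa using hδ.le
  · have hc' : (0 : ℝ) < c := by exact_mod_cast pos_iff_ne_zero.2 hc
    have h1 := h.measure_ge_le (Real.sqrt_nonneg (2 * c * Real.log (1 / δ)))
    rw [Real.sq_sqrt (by positivity)] at h1
    have h2 : -(2 * c * Real.log (1 / δ)) / (2 * c) = Real.log δ := by
      rw [one_div, Real.log_inv]
      field_simp
    rw [h2, Real.exp_log hδ] at h1
    have h3 : {ω | Real.sqrt (2 * c * Real.log (1 / δ)) < Z ω} ⊆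
        {ω | Real.sqrt (2 * c * Real.log (1 / δ)) ≤ Z ω} := by
      intro ω hω
      rw [Set.mem_ofPred_eq] at hω ⊢
      exact hω.le
    exact (measureReal_mono h3).trans h1

end concentration

/-! ### Symmetrization and uniform deviation bounds -/

section symmetrization

variable {E : Type*}

/-- The values of a function at `n` points. -/
noncomputable def sampleVec {n : ℕ} (g : E → ℝ) (y : Fin n → E) : EuclideanSpace ℝ (Fin n) :=
  WithLp.toLp 2 fun i => g (y i)

lemma radSum_sampleVec {n : ℕ} (s : Fin n → Bool) (g : E → ℝ) (y : Fin n → E) :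
    radSum s (sampleVec g y) = ∑ i, sgn (s i) * g (y i) := rfl

lemma abs_ciSup_le {T : Type*} [Finite T] [Nonempty T] {f : T → ℝ} {C : ℝ}
    (h : ∀ t, |f t| ≤ C) : |⨆ t, f t| ≤ C := by
  obtain ⟨t, ht⟩ := exists_eq_ciSup_of_finite (f := f)
  rw [← ht]
  exact h t

variable [MeasurableSpace E] (μ : Measure E) [IsProbabilityMeasure μ]
variable {T : Type*} [Fintype T] {g : T → E → ℝ} {M : ℝ} {n : ℕ}

/-- Exchanging the coordinates of the pairs with a negative sign. -/
def signSwap (s : Fin n → Bool) (z : Fin n → E × E) : Fin n → E × E :=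
  fun i => if s i then z i else (z i).swap

/-- The two entries of each pair are exchangeable, so the integral in the symmetrization may be
averaged over all swaps. -/
lemma measurePreserving_signSwap (s : Fin n → Bool) :
    MeasurePreserving (signSwap (E := E) s) (Measure.pi fun _ => μ.prod μ)
      (Measure.pi fun _ => μ.prod μ) := by
  refine measurePreserving_pi (fun _ => μ.prod μ) (fun _ => μ.prod μ)
    (f := fun i z => if s i then z else z.swap) fun i => ?_
  by_cases h : s i
  · simp only [h, if_true]
    exact MeasurePreserving.id (μ.prod μ)
  · simpa [h] using Measure.measurePreserving_swap (μ := μ) (ν := μ)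

lemma abs_sum_sub_le {n : ℕ} {a b : Fin n → ℝ} (ha : ∀ i, |a i| ≤ M) (hb : ∀ i, |b i| ≤ M) :
    |∑ i, (a i - b i)| ≤ n * (M + M) := by
  refine (Finset.abs_sum_le_sum_abs _ _).trans ?_
  refine (Finset.sum_le_card_nsmul _ _ (M + M) fun i _ => ?_).trans_eq (by simp [mul_add])
  exact (abs_sub _ _).trans (add_le_add (ha i) (hb i))

lemma measurable_iSup_sum_sub (hg : ∀ t, Measurable (g t)) :
    Measurable fun z : Fin n → E × E => ⨆ t, ∑ i, (g t (z i).1 - g t (z i).2) := by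
  refine Measurable.iSup fun t => Finset.measurable_sum _ fun i _ => ?_
  exact ((hg t).comp (measurable_fst.comp (measurable_pi_apply i))).sub
    ((hg t).comp (measurable_snd.comp (measurable_pi_apply i)))

variable [Nonempty T]

/-- The symmetrized supremum has mean at most twice the Rademacher bound. -/
lemma integral_iSup_sum_sub_le (hg : ∀ t, Measurable (g t)) (hM : ∀ t e, |g t e| ≤ M) {Q : ℝ}
    (hQ : ∀ y : Fin n → E, signAvg (fun s => ⨆ t, radSum s (sampleVec (g t) y)) ≤ Q) :
    ∫ z : Fin n → E × E, ⨆ t, ∑ i, (g t (z i).1 - g t (z i).2)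
      ∂(Measure.pi fun _ => μ.prod μ) ≤ 2 * Q := by
  set Φ : (Fin n → E × E) → ℝ := fun z => ⨆ t, ∑ i, (g t (z i).1 - g t (z i).2) with hΦ
  have hΦm : Measurable Φ := measurable_iSup_sum_sub hg
  have hΦb : ∀ z, |Φ z| ≤ n * (M + M) := fun z =>
    abs_ciSup_le fun t => abs_sum_sub_le (fun i => hM t _) fun i => hM t _
  have hswap : ∀ s : Fin n → Bool, ∫ z, Φ (signSwap s z) ∂(Measure.pi fun _ => μ.prod μ) =
      ∫ z, Φ z ∂(Measure.pi fun _ => μ.prod μ) := by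
    intro s
    have h := measurePreserving_signSwap μ s
    conv_rhs => rw [← h.map_eq]
    rw [integral_map h.measurable.aemeasurable hΦm.aestronglyMeasurable]
  have hint : ∀ s : Fin n → Bool,
      Integrable (fun z => Φ (signSwap s z)) (Measure.pi fun _ => μ.prod μ) := fun s =>
    integrable_of_measurable_of_abs_le
      (hΦm.comp (measurePreserving_signSwap μ s).measurable) fun z => hΦb _
  have h1 : ∫ z, Φ z ∂(Measure.pi fun _ => μ.prod μ) =
      ∫ z, signAvg (fun s => Φ (signSwap s z)) ∂(Measure.pi fun _ => μ.prod μ) := by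
    simp only [signAvg]
    rw [integral_div, integral_finsetSum _ fun s _ => hint s]
    simp [hswap]
  rw [h1]
  have h2 : ∀ z, signAvg (fun s => Φ (signSwap s z)) ≤ 2 * Q := by
    intro z
    -- A swapped difference carries the sign `s i` on the first entry and its negation on the
    -- second; the two suprema then separate.
    have h3 : ∀ s : Fin n → Bool, Φ (signSwap s z) ≤
        (⨆ t, radSum s (sampleVec (g t) fun i => (z i).1)) +
        ⨆ t, radSum (fun i => !(s i)) (sampleVec (g t) fun i => (z i).2) := by
      intro s
      refine le_trans (le_of_eq ?_) (iSup_add_le_of_finite _ _)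
      refine iSup_congr fun t => ?_
      rw [radSum_sampleVec, radSum_sampleVec, ← Finset.sum_add_distrib]
      refine Finset.sum_congr rfl fun i _ => ?_
      by_cases h : s i
      · simp [signSwap, sgn, h, sub_eq_add_neg]
      · simp [signSwap, sgn, h, sub_eq_add_neg, add_comm]
    refine (signAvg_mono h3).trans ?_
    rw [signAvg_add, signAvg_not fun s => ⨆ t, radSum s (sampleVec (g t) fun i => (z i).2)]
    linarith [hQ fun i => (z i).1, hQ fun i => (z i).2]
  have h4 : Integrable (fun z => signAvg fun s => Φ (signSwap s z))
      (Measure.pi fun _ => μ.prod μ) :=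
    (integrable_finsetSum _ fun s _ => hint s).div_const _
  exact (integral_mono h4 (integrable_const _) h2).trans_eq (by simp)

/-- **Symmetrization** with a ghost sample. -/
lemma integral_iSup_gap_le (hg : ∀ t, Measurable (g t)) (hM : ∀ t e, |g t e| ≤ M) {Q : ℝ}
    (hQ : ∀ y : Fin n → E, signAvg (fun s => ⨆ t, radSum s (sampleVec (g t) y)) ≤ Q) :
    ∫ y : Fin n → E, ⨆ t, ∑ i, ((∫ e, g t e ∂μ) - g t (y i)) ∂(Measure.pi fun _ => μ) ≤
      2 * Q := by
  refine le_trans ?_ (integral_iSup_sum_sub_le μ hg hM hQ)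
  set π : Measure (Fin n → E) := Measure.pi fun _ => μ
  have hmp := measurePreserving_arrowProdEquivProdArrow E E (Fin n) (fun _ => μ) (fun _ => μ)
  set F : (Fin n → E) × (Fin n → E) → ℝ := fun p => ⨆ t, ∑ i, (g t (p.1 i) - g t (p.2 i)) with hF
  have hFm : Measurable F := by
    refine Measurable.iSup fun t => Finset.measurable_sum _ fun i _ => ?_
    exact ((hg t).comp ((measurable_pi_apply i).comp measurable_fst)).sub
      ((hg t).comp ((measurable_pi_apply i).comp measurable_snd))
  have hFb : ∀ p, |F p| ≤ n * (M + M) := fun p =>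
    abs_ciSup_le fun t => abs_sum_sub_le (fun i => hM t _) fun i => hM t _
  have hFint : Integrable F (π.prod π) := integrable_of_measurable_of_abs_le hFm hFb
  have h1 : ∫ z : Fin n → E × E, ⨆ t, ∑ i, (g t (z i).1 - g t (z i).2)
      ∂(Measure.pi fun _ => μ.prod μ) = ∫ p, F p ∂(π.prod π) :=
    hmp.integral_comp' (g := F)
  rw [h1, integral_prod_symm _ hFint]
  have hIm : ∀ t, |∫ e, g t e ∂μ| ≤ M := fun t => abs_integral_le_of_abs_le (hM t)
  refine integral_mono (integrable_of_measurable_of_abs_le (C := n * (M + M)) ?_ fun y =>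
    abs_ciSup_le fun t => abs_sum_sub_le (fun _ => hIm t) fun i => hM t _)
    hFint.integral_prod_right fun y => ?_
  · refine Measurable.iSup fun t => Finset.measurable_sum _ fun i _ => ?_
    exact ((hg t).comp (measurable_pi_apply i)).const_sub _
  · refine ciSup_le fun t => ?_
    have hgi : ∀ i, Integrable (fun y' : Fin n → E => g t (y' i)) π := fun i =>
      integrable_of_measurable_of_abs_le ((hg t).comp (measurable_pi_apply i)) fun y' => hM t _
    -- The population mean is an average over a ghost sample, and a supremum of integrals is at most
    -- the integral of the supremum.
    have h2 : ∑ i, ((∫ e, g t e ∂μ) - g t (y i)) = ∫ y', ∑ i, (g t (y' i) - g t (y i)) ∂π := by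
      have h3 := integral_finsetSum (μ := π) Finset.univ
        (f := fun i (y' : Fin n → E) => g t (y' i) - g t (y i))
        fun i _ => (hgi i).sub (integrable_const _)
      rw [h3]
      refine Finset.sum_congr rfl fun i _ => ?_
      rw [integral_sub (hgi i) (integrable_const _),
        integral_comp_eval (μ := fun _ : Fin n => μ) (hg t).aestronglyMeasurable]
      simp
    rw [h2]
    refine integral_mono (integrable_finsetSum _ fun i _ => (hgi i).sub (integrable_const _))
      (integrable_of_measurable_of_abs_le (hFm.comp measurable_prodMk_right) fun y' => hFb _)
      fun y' => ?_
    exact le_ciSup (f := fun t => ∑ i, (g t (y' i) - g t (y i))) (Set.finite_range _).bddAbove t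

/-- The uniform deviation bound for a finite class, in terms of a Rademacher bound. -/
lemma measureReal_exists_gap_le (hg : ∀ t, Measurable (g t))
    (hM : ∀ t e, g t e ∈ Set.Icc 0 M) {Q : ℝ}
    (hQ : ∀ y : Fin n → E, signAvg (fun s => ⨆ t, radSum s (sampleVec (g t) y)) ≤ Q) {δ : ℝ}
    (hδ : 0 < δ) (hδ1 : δ < 1) :
    (Measure.pi fun _ : Fin n => μ).real {y | ∃ t, 2 * Q +
      Real.sqrt (n * M ^ 2 / 2 * Real.log (1 / δ)) < ∑ i, ((∫ e, g t e ∂μ) - g t (y i))} ≤ δ := by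
  classical
  have hMabs : ∀ t e, |g t e| ≤ M := fun t e => by
    rw [abs_of_nonneg (hM t e).1]
    exact (hM t e).2
  set H : (Fin n → E) → ℝ := fun y => ⨆ t, ∑ i, ((∫ e, g t e ∂μ) - g t (y i)) with hH
  have hHm : Measurable H := by
    refine Measurable.iSup fun t => Finset.measurable_sum _ fun i _ => ?_
    exact ((hg t).comp (measurable_pi_apply i)).const_sub _
  have hHb : ∀ y, |H y| ≤ n * (M + M) := fun y => abs_ciSup_le fun t =>
    abs_sum_sub_le (fun _ => abs_integral_le_of_abs_le (hMabs t)) fun i => hMabs t _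
  -- Values in `[0, M]` give differences at most `M`, rather than the `2M` that an absolute bound
  -- would give.
  have hHc : ∀ y i e, H y - H (Function.update y i e) ≤ M := by
    intro y i e
    rw [sub_le_iff_le_add]
    refine ciSup_le fun t => ?_
    have h1 : ∑ j, ((∫ e, g t e ∂μ) - g t (Function.update y i e j)) ≤
        H (Function.update y i e) :=
      le_ciSup (f := fun t => ∑ j, ((∫ e, g t e ∂μ) - g t (Function.update y i e j)))
        (Set.finite_range _).bddAbove t
    have h2 : ∑ j, ((∫ e, g t e ∂μ) - g t (y j)) -
        ∑ j, ((∫ e, g t e ∂μ) - g t (Function.update y i e j)) = g t e - g t (y i) := by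
      rw [← Finset.sum_sub_distrib, Finset.sum_eq_single i]
      · simp
      · intro j _ hj
        simp [hj]
      · simp
    linarith [(hM t e).2, (hM t (y i)).1]
  have hsub := hasSubgaussianMGF_pi μ n hHm hHb hHc
  refine le_trans (measureReal_mono ?_) (measureReal_sqrt_lt_le hsub hδ hδ1)
  rintro y ⟨t, ht⟩
  have h1 : ∑ i, ((∫ e, g t e ∂μ) - g t (y i)) ≤ H y :=
    le_ciSup (f := fun t => ∑ i, ((∫ e, g t e ∂μ) - g t (y i))) (Set.finite_range _).bddAbove t
  have h2 := integral_iSup_gap_le μ hg hMabs hQ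
  have h3 : 2 * ((Real.toNNReal (n * M ^ 2 / 4) : ℝ≥0) : ℝ) * Real.log (1 / δ) =
      n * M ^ 2 / 2 * Real.log (1 / δ) := by
    rw [Real.coe_toNNReal _ (by positivity)]
    ring
  simp only [Set.mem_ofPred_eq, h3]
  linarith

/-- The uniform deviation bound for a countable class. -/
theorem measure_exists_gap_le {g : ℕ → E → ℝ} (hg : ∀ k, Measurable (g k))
    (hM : ∀ k e, g k e ∈ Set.Icc 0 M) {Q : ℝ}
    (hQ : ∀ (m : ℕ) (y : Fin n → E),
      signAvg (fun s => ⨆ k : Fin (m + 1), radSum s (sampleVec (g k) y)) ≤ Q) {δ : ℝ}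
    (hδ : 0 < δ) (hδ1 : δ < 1) :
    (Measure.pi fun _ : Fin n => μ) {y | ∃ k, 2 * Q +
      Real.sqrt (n * M ^ 2 / 2 * Real.log (1 / δ)) < ∑ i, ((∫ e, g k e ∂μ) - g k (y i))} ≤
      ENNReal.ofReal δ := by
  set c := 2 * Q + Real.sqrt (n * M ^ 2 / 2 * Real.log (1 / δ))
  set A : ℕ → Set (Fin n → E) := fun m =>
    {y | ∃ k : Fin (m + 1), c < ∑ i, ((∫ e, g k e ∂μ) - g k (y i))} with hA
  -- The finite subclasses increase and obey a bound free of `m`, so continuity from below loses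
  -- nothing.
  have hmono : Monotone A := by
    rintro m m' h y ⟨k, hk⟩
    exact ⟨⟨k, by omega⟩, hk⟩
  have hset : {y : Fin n → E | ∃ k, c < ∑ i, ((∫ e, g k e ∂μ) - g k (y i))} = ⋃ m, A m := by
    ext y
    simp only [Set.mem_ofPred_eq, Set.mem_iUnion, hA]
    constructor
    · rintro ⟨k, hk⟩
      exact ⟨k, ⟨k, by omega⟩, hk⟩
    · rintro ⟨m, k, hk⟩
      exact ⟨k, hk⟩
  rw [hset, hmono.measure_iUnion]
  refine iSup_le fun m => ?_
  have h := measureReal_exists_gap_le μ (g := fun k : Fin (m + 1) => g k) (fun k => hg k)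
    (fun k => hM k) (hQ m) hδ hδ1
  rw [measureReal_def] at h
  exact (ENNReal.le_ofReal_iff_toReal_le (measure_ne_top _ _) hδ.le).2 h

end symmetrization

/-! ### The normalized divergence as a Lipschitz loss -/

section loss

variable {n d : ℕ} (h : n = 2 * d)

lemma norm_meanPart_le (v : EuclideanSpace ℝ (Fin n)) : ‖meanPart h v‖ ≤ ‖v‖ := by
  rw [EuclideanSpace.norm_eq, EuclideanSpace.norm_eq]
  refine Real.sqrt_le_sqrt ?_
  have hinj : Function.Injective fun j : Fin d => (⟨j, by omega⟩ : Fin n) := by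
    intro i j hij
    simpa [Fin.ext_iff] using hij
  calc ∑ j, ‖meanPart h v j‖ ^ 2 = ∑ i ∈ Finset.univ.map ⟨_, hinj⟩, ‖v i‖ ^ 2 := by
        rw [Finset.sum_map]
        rfl
    _ ≤ ∑ i, ‖v i‖ ^ 2 :=
        Finset.sum_le_univ_sum_of_nonneg fun i => sq_nonneg _

lemma meanPart_sub (u v : EuclideanSpace ℝ (Fin n)) :
    meanPart h u - meanPart h v = meanPart h (u - v) := rfl

lemma abs_logVarPart_le (v : EuclideanSpace ℝ (Fin n)) (j : Fin d) : |logVarPart h v j| ≤ ‖v‖ :=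
  PiLp.norm_apply_le v _

lemma abs_exp_sub_sub_le {R x y : ℝ} (hx : |x| ≤ R) (hy : |y| ≤ R) :
    |(Real.exp x - x) - (Real.exp y - y)| ≤ Real.exp R * |x - y| := by
  have hR : 0 ≤ R := (abs_nonneg x).trans hx
  have key : ∀ a b : ℝ, b ≤ a → a ≤ R →
      |(Real.exp a - a) - (Real.exp b - b)| ≤ Real.exp R * |a - b| := by
    intro a b hba ha
    have h1 : Real.exp b ≤ Real.exp a := Real.exp_le_exp.2 hba
    have h2 : Real.exp a - Real.exp b ≤ Real.exp a * (a - b) := by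
      have h3 := Real.add_one_le_exp (b - a)
      have h4 : Real.exp b = Real.exp a * Real.exp (b - a) := by
        rw [← Real.exp_add]
        ring_nf
      rw [h4]
      nlinarith [Real.exp_pos a]
    have h3 : Real.exp a ≤ Real.exp R := Real.exp_le_exp.2 ha
    have h4 : 1 ≤ Real.exp R := Real.one_le_exp hR
    rw [abs_of_nonneg (sub_nonneg.2 hba), abs_le]
    constructor <;> nlinarith
  rcases le_total y x with hxy | hxy
  · exact key x y hxy (abs_le.1 hx).2
  · rw [abs_sub_comm, abs_sub_comm x y]
    exact key y x hxy (abs_le.1 hy).2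

/-- Grouping by coordinates exposes the terms `exp ε - ε - 1 ≥ 0` and turns Lipschitz bounds into a
coordinatewise matter. -/
lemma klReg_eq (v : EuclideanSpace ℝ (Fin n)) :
    klReg h v = 1 / (2 * (d : ℝ)) *
      (‖meanPart h v‖ ^ 2 + ∑ j, ((Real.exp (logVarPart h v j) - logVarPart h v j) - 1)) := by
  rw [klReg, Finset.sum_sub_distrib, Finset.sum_sub_distrib]
  simp only [Finset.sum_const, Finset.card_univ, Fintype.card_fin, nsmul_eq_mul, mul_one]
  ring

lemma klReg_nonneg (v : EuclideanSpace ℝ (Fin n)) : 0 ≤ klReg h v := by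
  rw [klReg_eq]
  refine mul_nonneg (by positivity) (add_nonneg (sq_nonneg _) (Finset.sum_nonneg fun j _ => ?_))
  linarith [Real.add_one_le_exp (logVarPart h v j)]

lemma klReg_zero : klReg h 0 = 0 := by
  have h1 : meanPart h 0 = 0 := rfl
  have h2 : ∀ j, logVarPart h 0 j = 0 := fun _ => rfl
  simp [klReg_eq, h1, h2]

/-- The normalized divergence is Lipschitz on balls. -/
lemma abs_klReg_sub_le (hd : 1 ≤ d) {R : ℝ} {u v : EuclideanSpace ℝ (Fin n)} (hu : ‖u‖ ≤ R)
    (hv : ‖v‖ ≤ R) : |klReg h u - klReg h v| ≤ 2 * Real.exp R * ‖u - v‖ := by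
  have hd' : (1 : ℝ) ≤ d := by exact_mod_cast hd
  have hexp : R ≤ Real.exp R := by linarith [Real.add_one_le_exp R]
  have hR : 0 ≤ R := (norm_nonneg u).trans hu
  have h1 : |‖meanPart h u‖ ^ 2 - ‖meanPart h v‖ ^ 2| ≤ 2 * Real.exp R * ‖u - v‖ := by
    rw [sq_sub_sq, abs_mul, abs_of_nonneg (by positivity)]
    have h2 := norm_meanPart_le h u
    have h3 := norm_meanPart_le h v
    refine mul_le_mul (by linarith) ?_ (abs_nonneg _) (by positivity)
    refine (abs_norm_sub_norm_le _ _).trans ?_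
    rw [meanPart_sub]
    exact norm_meanPart_le h _
  have h2 : |∑ j, (((Real.exp (logVarPart h u j) - logVarPart h u j) - 1) -
      ((Real.exp (logVarPart h v j) - logVarPart h v j) - 1))| ≤ d * (Real.exp R * ‖u - v‖) := by
    refine (Finset.abs_sum_le_sum_abs _ _).trans ?_
    refine (Finset.sum_le_card_nsmul _ _ (Real.exp R * ‖u - v‖) fun j _ => ?_).trans_eq (by simp)
    rw [sub_sub_sub_cancel_right]
    refine (abs_exp_sub_sub_le ((abs_logVarPart_le h u j).trans hu)
      ((abs_logVarPart_le h v j).trans hv)).trans ?_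
    gcongr
    exact abs_logVarPart_le h (u - v) j
  have h3 : klReg h u - klReg h v = 1 / (2 * (d : ℝ)) *
      ((‖meanPart h u‖ ^ 2 - ‖meanPart h v‖ ^ 2) +
      ∑ j, (((Real.exp (logVarPart h u j) - logVarPart h u j) - 1) -
        ((Real.exp (logVarPart h v j) - logVarPart h v j) - 1))) := by
    rw [klReg_eq, klReg_eq, Finset.sum_sub_distrib
      (fun j => (Real.exp (logVarPart h u j) - logVarPart h u j) - 1)]
    ring
  rw [h3, abs_mul, abs_of_nonneg (by positivity), one_div_mul_eq_div, div_le_iff₀ (by positivity)]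
  refine (abs_add_le _ _).trans ((add_le_add h1 h2).trans ?_)
  have h4 : 0 ≤ Real.exp R * ‖u - v‖ := by positivity
  nlinarith

lemma klReg_le (hd : 1 ≤ d) {R : ℝ} {v : EuclideanSpace ℝ (Fin n)} (hv : ‖v‖ ≤ R) :
    klReg h v ≤ 2 * Real.exp R * R := by
  have hR : 0 ≤ R := (norm_nonneg v).trans hv
  have h1 := abs_klReg_sub_le h hd hv (v := 0) (by simpa using hR)
  rw [klReg_zero, sub_zero, sub_zero] at h1
  refine (le_abs_self _).trans (h1.trans ?_)
  gcongr

lemma continuous_klReg : Continuous (klReg h) := by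
  have h1 : Continuous (meanPart h) := by
    unfold meanPart
    fun_prop
  have h2 : Continuous (logVarPart h) := by
    unfold logVarPart
    fun_prop
  unfold klReg
  fun_prop

end loss

/-! ### Continuity in the weights and reduction to a dense sequence -/

section continuity

variable {L : ℕ} {w : Fin (L + 1) → ℕ} {α : Activations w} {σ : Fin L → ℝ≥0}

/-- Joint continuity serves twice: in the input for measurability, in the weights for passing to a
dense sequence. -/
lemma continuous_layerOutput (hα : ∀ ℓ, LipschitzWith (σ ℓ) (α ℓ)) (ℓ : Fin (L + 1)) :
    Continuous fun p : Weights w × EuclideanSpace ℝ (Fin (w 0)) => layerOutput α p.1 p.2 ℓ := by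
  induction ℓ using Fin.induction with
  | zero => exact continuous_snd
  | succ ℓ ih =>
    simp only [layerOutput_succ]
    refine (hα ℓ).continuous.comp ?_
    simp only [Matrix.toLpLin_apply]
    refine (PiLp.continuous_toLp 2 _).comp (Continuous.matrix_mulVec ?_ ?_)
    · exact (continuous_apply ℓ).comp continuous_fst
    · exact (PiLp.continuous_ofLp 2 _).comp ih

instance (w : Fin (L + 1) → ℕ) : SecondCountableTopology (Weights w) :=
  have (ℓ : Fin L) :
      SecondCountableTopology (Matrix (Fin (w ℓ.succ)) (Fin (w ℓ.castSucc)) ℝ) :=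
    inferInstanceAs (SecondCountableTopology (Fin (w ℓ.succ) → Fin (w ℓ.castSucc) → ℝ))
  inferInstanceAs (SecondCountableTopology
    ((ℓ : Fin L) → Matrix (Fin (w ℓ.succ)) (Fin (w ℓ.castSucc)) ℝ))

end continuity

/-- The uniform deviation bound for a class with a second countable index space. -/
theorem measure_exists_gap_le_of_secondCountable {E : Type*} [MeasurableSpace E] (μ : Measure E)
    [IsProbabilityMeasure μ] {T : Type*} [TopologicalSpace T] [SecondCountableTopology T]
    {g : T → E → ℝ} {M : ℝ} {n : ℕ} (hgm : ∀ t, Measurable (g t))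
    (hgc : ∀ e, Continuous fun t => g t e) (hM : ∀ t e, g t e ∈ Set.Icc 0 M) {Q : ℝ}
    (hQ : ∀ (m : ℕ) (D : Fin (m + 1) → T) (y : Fin n → E),
      signAvg (fun s => ⨆ k, radSum s (sampleVec (g (D k)) y)) ≤ Q) {δ : ℝ}
    (hδ : 0 < δ) (hδ1 : δ < 1) :
    (Measure.pi fun _ : Fin n => μ) {y | ∃ t, 2 * Q +
      Real.sqrt (n * M ^ 2 / 2 * Real.log (1 / δ)) < ∑ i, ((∫ e, g t e ∂μ) - g t (y i))} ≤
      ENNReal.ofReal δ := by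
  rcases isEmpty_or_nonempty T with hT | hT
  · simp
  set D := TopologicalSpace.denseSeq T
  refine le_trans (measure_mono ?_) (measure_exists_gap_le μ (g := fun k => g (D k))
    (fun k => hgm _) (fun k => hM _) (fun m => hQ m fun k => D k) hδ hδ1)
  rintro y ⟨t, ht⟩
  by_contra hcon
  refine absurd ht (not_lt.2 ?_)
  have hcI : Continuous fun t => ∫ e, g t e ∂μ := by
    refine continuous_of_dominated (fun t => (hgm t).aestronglyMeasurable) (bound := fun _ => M)
      (fun t => Filter.Eventually.of_forall fun e => ?_) (integrable_const _)
      (Filter.Eventually.of_forall hgc)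
    rw [Real.norm_eq_abs, abs_of_nonneg (hM t e).1]
    exact (hM t e).2
  -- The gap is continuous in `t`, by dominated convergence for the mean, so a bound along the dense
  -- sequence extends to all of `T`.
  have hclosed : IsClosed {t | ∑ i, ((∫ e, g t e ∂μ) - g t (y i)) ≤
      2 * Q + Real.sqrt (n * M ^ 2 / 2 * Real.log (1 / δ))} :=
    isClosed_le (continuous_finsetSum _ fun i _ => hcI.sub (hgc _)) continuous_const
  exact (TopologicalSpace.denseRange_denseSeq T).induction_on t hclosed
    fun k => not_lt.1 fun h => hcon ⟨k, h⟩

/-! ### Assembly of the generalization bound -/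

section main

variable {L : ℕ} {w : Fin (L + 1) → ℕ} {α : Activations w} {σ : Fin L → ℝ≥0} {Θ₀ : Weights w}
  {ρ a : Fin L → ℝ} {d : ℕ}

lemma norm_network_le (hα : ∀ ℓ, LipschitzWith (σ ℓ) (α ℓ)) (hα0 : ∀ ℓ, α ℓ 0 = 0)
    (hρ : ∀ ℓ, 0 < ρ ℓ) {Θ : Weights w} (hΘ : Θ ∈ weightSet Θ₀ ρ a) {B : ℝ}
    {x : EuclideanSpace ℝ (Fin (w 0))} (hx : ‖x‖ ≤ B) :
    ‖network α Θ x‖ ≤ B * ∏ ℓ, ρ ℓ * σ ℓ := by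
  have h := norm_layerOutput_le hα hα0 hρ hΘ x (Fin.last L)
  rw [below_last] at h
  have h1 := prod_mul_nonneg (σ := σ) hρ Finset.univ
  refine h.trans ?_
  rw [mul_comm]
  gcongr

/-- The Rademacher complexity of the normalized divergence over finitely many networks. -/
lemma signAvg_klReg_network_le (hd : 1 ≤ d) {n : ℕ} (hn : 1 ≤ n) (hw : w (Fin.last L) = 2 * d)
    (hα : ∀ ℓ, LipschitzWith (σ ℓ) (α ℓ)) (hα0 : ∀ ℓ, α ℓ 0 = 0) (hρ : ∀ ℓ, 0 < ρ ℓ)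
    (ha : ∀ ℓ, 0 ≤ a ℓ) {T : Type*} [Fintype T] [Nonempty T] (Θ : T → Weights w)
    (hΘ : ∀ t, Θ t ∈ weightSet Θ₀ ρ a) {B : ℝ} (hB : 0 ≤ B)
    (x : Fin n → EuclideanSpace ℝ (Fin (w 0))) (hx : ∀ i, ‖x i‖ ≤ B) :
    signAvg (fun s => ⨆ t, radSum s (sampleVec (fun y => klReg hw (network α (Θ t) y)) x)) ≤
      14 * (2 * Real.exp (B * ∏ ℓ, ρ ℓ * σ ℓ) * (B * ∏ ℓ, ρ ℓ * σ ℓ) * Real.sqrt n) *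
        (Real.sqrt (32 * Real.log (2 * (maxWidth w * n) + 1)) * complexity ρ a) *
        (1 + Real.log n) := by
  classical
  have hG : 0 ≤ ∏ ℓ, ρ ℓ * (σ ℓ : ℝ) := prod_mul_nonneg hρ Finset.univ
  set G := ∏ ℓ, ρ ℓ * (σ ℓ : ℝ)
  have hlog : 0 ≤ Real.log (2 * (maxWidth w * n) + 1) :=
    Real.log_nonneg (le_add_of_nonneg_left (by positivity))
  have hS : 0 ≤ complexity ρ a := Real.rpow_nonneg
    (Finset.sum_nonneg fun ℓ _ => Real.rpow_nonneg (div_nonneg (ha ℓ) (hρ ℓ).le) _) _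
  refine signAvg_iSup_radSum_le_of_entropy hn _ (by positivity) (by positivity) fun τ hτ => ?_
  set X : Batch n (w 0) := WithLp.toLp 2 x with hX
  have hXn : ‖X‖ ≤ B * Real.sqrt n := by
    have h := norm_piLp_le_mul (U := X) (V := (WithLp.toLp 2 fun _ => 1 : EuclideanSpace ℝ (Fin n)))
      hB fun i => by simpa [hX] using hx i
    refine h.trans (le_of_eq ?_)
    rw [EuclideanSpace.norm_eq]
    simp
  obtain ⟨t, hts, htc, ht⟩ := exists_network_cover (Θ₀ := Θ₀) hα hα0 hρ ha hτ X
  choose Θ' hΘ' hdist using fun k => ht (Θ k) (hΘ k)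
  refine ⟨fun k => sampleVec (fun y => klReg hw (network α (Θ' k) y)) x, ?_, fun k => ?_⟩
  · have hsub : (Finset.univ.image fun k => sampleVec (fun y => klReg hw (network α (Θ' k) y)) x) ⊆
        t.image fun Θ => sampleVec (fun y => klReg hw (network α Θ y)) x := by
      intro v hv
      obtain ⟨k, -, rfl⟩ := Finset.mem_image.1 hv
      exact Finset.mem_image_of_mem _ (hΘ' k)
    have hcard := (Finset.card_le_card hsub).trans Finset.card_image_le
    calc ((Finset.univ.image _).card : ℝ) ≤ t.card := by exact_mod_cast hcard
      _ ≤ _ := htc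
      _ = _ := by rw [mul_pow, Real.sq_sqrt (by positivity)]
  · have h1 : ‖sampleVec (fun y => klReg hw (network α (Θ k) y)) x -
        sampleVec (fun y => klReg hw (network α (Θ' k) y)) x‖ ≤ 2 * Real.exp (B * G) *
          ‖batchOutput α (Θ k) X (Fin.last L) - batchOutput α (Θ' k) X (Fin.last L)‖ := by
      refine norm_piLp_le_mul (by positivity) fun i => ?_
      -- Properness of the cover is used here: the approximating network satisfies the same norm
      -- bound, so both outputs lie in the ball where the loss is Lipschitz.
      exact abs_klReg_sub_le hw hd (norm_network_le hα hα0 hρ (hΘ k) (hx i))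
        (norm_network_le hα hα0 hρ (hts (hΘ' k)) (hx i))
    refine h1.trans ?_
    calc 2 * Real.exp (B * G) * _ ≤ 2 * Real.exp (B * G) * (G * ‖X‖ * τ) := by
          gcongr
          exact hdist k
      _ ≤ 2 * Real.exp (B * G) * (G * (B * Real.sqrt n) * τ) := by gcongr
      _ = _ := by ring

/-- Since `2Wn + 1 ≤ W³ n`, the logarithm is at most `3 log W + log n`. As `log W ≥ log 2`, the sum
is absorbed by a product, which separates the width from the sample size. -/
lemma log_width_mul_sample_le {W n : ℕ} (hW : 2 ≤ W) (hn : 1 ≤ n) :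
    32 * Real.log (2 * (W * n) + 1) ≤ (10 * Real.sqrt (Real.log W) * (1 + Real.log n)) ^ 2 := by
  have hW' : (2 : ℝ) ≤ W := by exact_mod_cast hW
  have hn' : (1 : ℝ) ≤ n := by exact_mod_cast hn
  have h1 : (2 * (W * n) + 1 : ℝ) ≤ W ^ 3 * n := by
    have h2 : (4 : ℝ) ≤ W ^ 2 := by nlinarith
    have h3 : (1 : ℝ) ≤ W * n := by nlinarith
    calc (2 * (W * n) + 1 : ℝ) ≤ 4 * (W * n) := by linarith
      _ ≤ W ^ 2 * (W * n) := by gcongr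
      _ = W ^ 3 * n := by ring
  have h2 := Real.log_le_log (by positivity) h1
  rw [Real.log_mul (by positivity) (by positivity), Real.log_pow] at h2
  have h3 : Real.log 2 ≤ Real.log W := Real.log_le_log (by norm_num) hW'
  have h4 := Real.log_two_gt_d9
  have h5 := Real.log_nonneg hn'
  rw [mul_pow, mul_pow, Real.sq_sqrt (by linarith)]
  push_cast at h2
  nlinarith [mul_nonneg h5 (sub_nonneg.2 (h4.le.trans h3)), mul_nonneg h5 h5,
    mul_nonneg (mul_nonneg h5 h5) (sub_nonneg.2 (h4.le.trans h3))]

/-- The bound for the summed gap in terms of the rate. -/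
lemma gap_bound_le_rate {N : ℕ} (hN : 1 ≤ N) (hW : 2 ≤ maxWidth w) {B : ℝ} (hB : 0 ≤ B)
    (hρ : ∀ ℓ, 0 < ρ ℓ) (ha : ∀ ℓ, 0 ≤ a ℓ) {δ : ℝ} (hδ : 0 < δ) (hδ1 : δ < 1) :
    1 / (N : ℝ) * (2 * (14 * (2 * Real.exp (B * ∏ ℓ, ρ ℓ * σ ℓ) * (B * ∏ ℓ, ρ ℓ * σ ℓ) *
        Real.sqrt N) *
      (Real.sqrt (32 * Real.log (2 * (maxWidth w * N) + 1)) * complexity ρ a) *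
        (1 + Real.log N)) +
      Real.sqrt (N * (2 * Real.exp (B * ∏ ℓ, ρ ℓ * σ ℓ) * (B * ∏ ℓ, ρ ℓ * σ ℓ)) ^ 2 / 2 *
        Real.log (1 / δ))) ≤
      562 * (1 + Real.log N) ^ 2 * rate N (maxWidth w) B ρ a σ δ := by
  have hG : 0 ≤ ∏ ℓ, ρ ℓ * (σ ℓ : ℝ) := prod_mul_nonneg hρ Finset.univ
  have hN' : (1 : ℝ) ≤ N := by exact_mod_cast hN
  have hlogN := Real.log_nonneg hN'
  have hlog : 0 ≤ Real.log (1 / δ) := Real.log_nonneg (by rw [le_div_iff₀ hδ]; linarith)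
  have hS : 0 ≤ complexity ρ a := Real.rpow_nonneg
    (Finset.sum_nonneg fun ℓ _ => Real.rpow_nonneg (div_nonneg (ha ℓ) (hρ ℓ).le) _) _
  have hrate : rate N (maxWidth w) B ρ a σ δ =
      max 1 (Real.exp (B * ∏ ℓ, ρ ℓ * σ ℓ)) * B * (∏ ℓ, ρ ℓ * σ ℓ) / Real.sqrt N *
        max (Real.sqrt (Real.log (maxWidth w)) * complexity ρ a) (Real.sqrt (Real.log (1 / δ))) :=
    rfl
  rw [hrate, max_eq_right (Real.one_le_exp (mul_nonneg hB hG))]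
  set G := ∏ ℓ, ρ ℓ * (σ ℓ : ℝ)
  set S := complexity ρ a
  set l := Real.log (1 / δ)
  set W := maxWidth w
  set m := max (Real.sqrt (Real.log W) * S) (Real.sqrt l)
  have hm : 0 ≤ m := (Real.sqrt_nonneg l).trans (le_max_right _ _)
  set A := Real.exp (B * G) * (B * G) with hA
  have hA0 : 0 ≤ A := by positivity
  have hs : 0 < Real.sqrt N := Real.sqrt_pos.2 (by linarith)
  have hss : Real.sqrt N * Real.sqrt N = N := Real.mul_self_sqrt (by linarith)
  have h1 : Real.sqrt (32 * Real.log (2 * (W * N) + 1)) * S ≤ 10 * m * (1 + Real.log N) := by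
    have h2 := Real.sqrt_le_sqrt (log_width_mul_sample_le hW hN)
    rw [Real.sqrt_sq (by positivity)] at h2
    calc _ ≤ 10 * Real.sqrt (Real.log W) * (1 + Real.log N) * S := by gcongr
      _ = 10 * (Real.sqrt (Real.log W) * S) * (1 + Real.log N) := by ring
      _ ≤ _ := by
          gcongr
          exact le_max_left _ _
  have h2 : Real.sqrt (N * (2 * Real.exp (B * G) * (B * G)) ^ 2 / 2 * l) ≤
      2 * A * Real.sqrt N * m := by
    calc Real.sqrt (N * (2 * Real.exp (B * G) * (B * G)) ^ 2 / 2 * l)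
        ≤ Real.sqrt ((2 * A * Real.sqrt N * Real.sqrt l) ^ 2) := by
          refine Real.sqrt_le_sqrt ?_
          have h3 : 0 ≤ N * (2 * A) ^ 2 * l := by positivity
          have h4 : (2 * A * Real.sqrt N * Real.sqrt l) ^ 2 = N * (2 * A) ^ 2 * l := by
            rw [mul_pow, mul_pow, Real.sq_sqrt (by linarith), Real.sq_sqrt hlog]
            ring
          rw [h4, mul_assoc 2, ← hA]
          linarith
      _ = 2 * A * Real.sqrt N * Real.sqrt l := Real.sqrt_sq (by positivity)
      _ ≤ _ := by
          gcongr
          exact le_max_right _ _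
  have hinv : 1 / (N : ℝ) * Real.sqrt N = (Real.sqrt N)⁻¹ := by
    nth_rewrite 1 [← hss]
    field_simp
  calc _ ≤ 1 / (N : ℝ) * (2 * (14 * (2 * Real.exp (B * G) * (B * G) * Real.sqrt N) *
        (10 * m * (1 + Real.log N)) * (1 + Real.log N)) + 2 * A * Real.sqrt N * m) := by gcongr
    -- `560 = 2·14·2·10`: symmetrization, chaining, Lipschitz constant, separation of `log W`. The 2
    -- comes from the deviation term.
    _ = (560 * (1 + Real.log N) ^ 2 + 2) * (A / Real.sqrt N * m) := by
        rw [hA, div_eq_mul_inv _ (Real.sqrt N), ← hinv]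
        ring
    _ ≤ (562 * (1 + Real.log N) ^ 2) * (A / Real.sqrt N * m) := by
        gcongr
        nlinarith
    _ = _ := by
        rw [hA]
        ring

lemma norm_le_inputRadius {X : Set (EuclideanSpace ℝ (Fin (w 0)))} (hX : Bornology.IsBounded X)
    (y : X) : ‖(y : EuclideanSpace ℝ (Fin (w 0)))‖ ≤ inputRadius X := by
  obtain ⟨C, hC⟩ := hX.exists_norm_le
  refine le_ciSup (f := fun x : X => ‖(x : EuclideanSpace ℝ (Fin (w 0)))‖) ⟨C, ?_⟩ y
  rintro _ ⟨x, rfl⟩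
  exact hC x x.2

lemma continuous_klReg_network (hw : w (Fin.last L) = 2 * d)
    (hα : ∀ ℓ, LipschitzWith (σ ℓ) (α ℓ)) :
    Continuous fun p : Weights w × EuclideanSpace ℝ (Fin (w 0)) =>
      klReg hw (network α p.1 p.2) :=
  (continuous_klReg hw).comp (continuous_layerOutput hα (Fin.last L))

end main

/-- Transfer of a bad event for the product measure to an i.i.d. sample. -/
lemma one_sub_le_measureReal_of_iIndepFun {E : Type*} [MeasurableSpace E] {μ : Measure E}
    {Ω : Type*} [MeasurableSpace Ω] {P : Measure Ω} [IsProbabilityMeasure P] {N : ℕ}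
    {x : Fin N → Ω → E} (hx : ∀ i, Measurable (x i)) (hxμ : ∀ i, P.map (x i) = μ)
    (hind : iIndepFun x P) {δ : ℝ} (hδ : 0 ≤ δ) {bad : Set (Fin N → E)}
    (hbad : (Measure.pi fun _ => μ) bad ≤ ENNReal.ofReal δ) {good : Set Ω}
    (hgood : ∀ ω, (fun i => x i ω) ∉ bad → ω ∈ good) : 1 - δ ≤ P.real good := by
  have hmap : P.map (fun ω i => x i ω) = Measure.pi fun _ => μ := by
    rw [(iIndepFun_iff_map_fun_eq_pi_map fun i => (hx i).aemeasurable).1 hind]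
    simp_rw [hxμ]
  -- Neither `bad` nor `good` need be measurable: this inequality and subadditivity of `P` hold for
  -- arbitrary sets.
  have h1 := Measure.le_map_apply (μ := P) (measurable_pi_lambda _ hx).aemeasurable bad
  rw [hmap] at h1
  have h2 : P.real ((fun ω i => x i ω) ⁻¹' bad) ≤ δ :=
    ENNReal.toReal_le_of_le_ofReal hδ (h1.trans hbad)
  have h3 := measureReal_union_le (μ := P) ((fun ω i => x i ω) ⁻¹' bad) good
  have h4 : (fun ω i => x i ω) ⁻¹' bad ∪ good = Set.univ := by
    ext ω
    by_cases h : (fun i => x i ω) ∈ bad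
    · simp [h]
    · simp [hgood ω h]
  rw [h4, probReal_univ] at h3
  linarith

lemma genGap_le {E : Type*} [MeasurableSpace E] {n d N : ℕ} (hN : 1 ≤ N) (h : n = 2 * d)
    {F : Set (E → EuclideanSpace ℝ (Fin n))} {μ : Measure E} {s : Fin N → E} {c r : ℝ}
    (hF : ∀ f ∈ F, ∑ i, ((∫ e, klReg h (f e) ∂μ) - klReg h (f (s i))) ≤ c)
    (hr : 1 / (N : ℝ) * c ≤ r) : genGap h F μ s ≤ (r : EReal) := by
  refine iSup₂_le fun f hf => EReal.coe_le_coe_iff.2 (le_trans ?_ hr)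
  have hN0 : (N : ℝ) ≠ 0 := by positivity
  have hsum : (∫ e, klReg h (f e) ∂μ) - 1 / (N : ℝ) * ∑ i, klReg h (f (s i)) =
      1 / (N : ℝ) * ∑ i, ((∫ e, klReg h (f e) ∂μ) - klReg h (f (s i))) := by
    rw [Finset.sum_sub_distrib]
    simp only [Finset.sum_const, Finset.card_univ, Fintype.card_fin, nsmul_eq_mul]
    field_simp
  rw [hsum]
  exact mul_le_mul_of_nonneg_left (hF f hf) (by positivity)

section main

variable {L : ℕ} {w : Fin (L + 1) → ℕ} {α : Activations w} {σ : Fin L → ℝ≥0} {Θ₀ : Weights w}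
  {ρ a : Fin L → ℝ} {d : ℕ} {X : Set (EuclideanSpace ℝ (Fin (w 0)))}

lemma measurable_klReg_network (hw : w (Fin.last L) = 2 * d)
    (hα : ∀ ℓ, LipschitzWith (σ ℓ) (α ℓ)) (Θ : Weights w) :
    Measurable fun e : X => klReg hw (network α Θ e) :=
  ((continuous_klReg_network hw hα).comp
    (Continuous.prodMk continuous_const continuous_subtype_val)).measurable

lemma continuous_klReg_network_weights (hw : w (Fin.last L) = 2 * d)
    (hα : ∀ ℓ, LipschitzWith (σ ℓ) (α ℓ)) (x : EuclideanSpace ℝ (Fin (w 0))) :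
    Continuous fun Θ : Weights w => klReg hw (network α Θ x) :=
  Continuous.comp
    (g := fun p : Weights w × EuclideanSpace ℝ (Fin (w 0)) => klReg hw (network α p.1 p.2))
    (f := fun Θ => (Θ, x)) (continuous_klReg_network hw hα)
    (Continuous.prodMk continuous_id continuous_const)

lemma klReg_network_mem_Icc (hd : 1 ≤ d) (hw : w (Fin.last L) = 2 * d)
    (hα : ∀ ℓ, LipschitzWith (σ ℓ) (α ℓ)) (hα0 : ∀ ℓ, α ℓ 0 = 0) (hρ : ∀ ℓ, 0 < ρ ℓ)
    (hX : Bornology.IsBounded X) {Θ : Weights w} (hΘ : Θ ∈ weightSet Θ₀ ρ a) (e : X) :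
    klReg hw (network α Θ e) ∈ Set.Icc 0 (2 * Real.exp (inputRadius X * ∏ ℓ, ρ ℓ * σ ℓ) *
      (inputRadius X * ∏ ℓ, ρ ℓ * σ ℓ)) :=
  ⟨klReg_nonneg hw _,
    klReg_le hw hd (norm_network_le hα hα0 hρ hΘ (norm_le_inputRadius hX e))⟩

lemma integrable_klReg_network (hd : 1 ≤ d) (hw : w (Fin.last L) = 2 * d)
    (hα : ∀ ℓ, LipschitzWith (σ ℓ) (α ℓ)) (hα0 : ∀ ℓ, α ℓ 0 = 0) (hρ : ∀ ℓ, 0 < ρ ℓ)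
    (hX : Bornology.IsBounded X) (μ : Measure X) [IsProbabilityMeasure μ] {Θ : Weights w}
    (hΘ : Θ ∈ weightSet Θ₀ ρ a) : Integrable (fun e : X => klReg hw (network α Θ e)) μ := by
  refine integrable_of_measurable_of_abs_le (measurable_klReg_network hw hα Θ)
    (C := 2 * Real.exp (inputRadius X * ∏ ℓ, ρ ℓ * σ ℓ) *
      (inputRadius X * ∏ ℓ, ρ ℓ * σ ℓ)) fun e => ?_
  rw [abs_of_nonneg (klReg_network_mem_Icc hd hw hα hα0 hρ hX hΘ e).1]
  exact (klReg_network_mem_Icc hd hw hα hα0 hρ hX hΘ e).2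

/-- The output layer has width `2d ≥ 2`, which keeps `log W` away from zero; `1 ≤ L` makes this
layer one of those counted. -/
lemma two_le_maxWidth (hL : 1 ≤ L) (hd : 1 ≤ d) (hw : w (Fin.last L) = 2 * d) :
    2 ≤ maxWidth w := by
  have h := width_le_maxWidth w ⟨L - 1, by omega⟩
  have h1 : Fin.succ ⟨L - 1, by omega⟩ = Fin.last L := by
    ext
    simp
    omega
  rw [h1, hw] at h
  omega

/-- The generalization bound on the sample space. -/
theorem one_sub_le_measureReal_genGap_le (hL : 1 ≤ L) (hd : 1 ≤ d) {N : ℕ} (hN : 1 ≤ N)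
    (hw : w (Fin.last L) = 2 * d) (hα : ∀ ℓ, LipschitzWith (σ ℓ) (α ℓ)) (hα0 : ∀ ℓ, α ℓ 0 = 0)
    (hρ : ∀ ℓ, 0 < ρ ℓ) (ha : ∀ ℓ, 0 ≤ a ℓ) (hX : Bornology.IsBounded X) (μ : Measure X)
    [IsProbabilityMeasure μ] {Ω : Type*} [MeasurableSpace Ω] (P : Measure Ω)
    [IsProbabilityMeasure P] {x : Fin N → Ω → X} (hx : ∀ i, Measurable (x i))
    (hxμ : ∀ i, P.map (x i) = μ) (hind : iIndepFun x P) {δ : ℝ} (hδ : 0 < δ) (hδ1 : δ < 1) :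
    1 - δ ≤ P.real {ω | genGap hw (encoderClass X α Θ₀ ρ a) μ (fun i => x i ω) ≤
      ((562 * (1 + Real.log N) ^ 2 *
        rate N (maxWidth w) (inputRadius X) ρ a σ δ : ℝ) : EReal)} := by
  have hXne : Nonempty X := μ.nonempty_of_neZero
  have hB := norm_le_inputRadius hX
  have hB0 : 0 ≤ inputRadius X := (norm_nonneg _).trans (hB hXne.some)
  set g : weightSet Θ₀ ρ a → X → ℝ := fun Θ e => klReg hw (network α Θ.1 e) with hg
  have hgm : ∀ Θ, Measurable (g Θ) := fun Θ => measurable_klReg_network hw hα Θ.1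
  have hgc : ∀ e, Continuous fun Θ => g Θ e := fun e =>
    (continuous_klReg_network_weights hw hα e).comp continuous_subtype_val
  have hgM := fun Θ : weightSet Θ₀ ρ a => klReg_network_mem_Icc hd hw hα hα0 hρ hX Θ.2
  have hQ := fun (m : ℕ) (D : Fin (m + 1) → weightSet Θ₀ ρ a) (y : Fin N → X) =>
    signAvg_klReg_network_le hd hN hw hα hα0 hρ ha (fun k => (D k : Weights w))
      (fun k => (D k).2) hB0 (fun i => (y i : EuclideanSpace ℝ (Fin (w 0)))) fun i => hB _
  have hbad := measure_exists_gap_le_of_secondCountable (n := N) μ hgm hgc hgM hQ hδ hδ1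
  refine one_sub_le_measureReal_of_iIndepFun hx hxμ hind hδ.le hbad fun ω hω => ?_
  refine genGap_le hN hw ?_
    (gap_bound_le_rate (σ := σ) hN (two_le_maxWidth hL hd hw) hB0 hρ ha hδ hδ1)
  rintro f ⟨Θ, hΘ, rfl⟩
  exact not_lt.1 fun h => hω ⟨⟨Θ, hΘ⟩, h⟩

end main

end KLGen

theorem theorem2 :
    ∃ (C : ℝ) (k : ℕ), 0 < C ∧
      ∀ (L d N : ℕ) (_ : 1 ≤ L) (_ : 1 ≤ d) (_ : 1 ≤ N)
        -- the architecture: widths, activations, reference matrices, radii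
        (w : Fin (L + 1) → ℕ) (hw : w (Fin.last L) = 2 * d)
        (α : KLGen.Activations w) (σ : Fin L → ℝ≥0)
        (_ : ∀ ℓ, LipschitzWith (σ ℓ) (α ℓ)) (_ : ∀ ℓ, α ℓ 0 = 0)
        (Θ₀ : KLGen.Weights w) (ρ a : Fin L → ℝ) (_ : ∀ ℓ, 0 < ρ ℓ) (_ : ∀ ℓ, 0 ≤ a ℓ)
        -- the bounded input set and the data distribution on it
        (X : Set (EuclideanSpace ℝ (Fin (w 0)))) (_ : Bornology.IsBounded X)
        (μ : Measure X) (_ : IsProbabilityMeasure μ)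
        -- `N` independent samples with law `μ`
        (Ω : Type*) (_ : MeasurableSpace Ω) (P : Measure Ω) (_ : IsProbabilityMeasure P)
        (x : Fin N → Ω → X) (_ : ∀ i, Measurable (x i)) (_ : ∀ i, P.map (x i) = μ)
        (_ : iIndepFun x P)
        (δ : ℝ) (_ : 0 < δ) (_ : δ < 1),
        (∀ f ∈ KLGen.encoderClass X α Θ₀ ρ a, Integrable (fun y => KLGen.klReg hw (f y)) μ) ∧
        1 - δ ≤ P.real {ω |
          KLGen.genGap hw (KLGen.encoderClass X α Θ₀ ρ a) μ (fun i => x i ω) ≤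
            ((C * (1 + Real.log N) ^ k *
              KLGen.rate N (KLGen.maxWidth w) (KLGen.inputRadius X) ρ a σ δ : ℝ) : EReal)} := by
  refine ⟨562, 2, by norm_num, ?_⟩
  intro L d N hL hd hN w hw α σ hα hα0 Θ₀ ρ a hρ ha X hX μ _ Ω _ P _ x hx hxμ hind δ hδ hδ1
  refine ⟨?_, KLGen.one_sub_le_measureReal_genGap_le hL hd hN hw hα hα0 hρ ha hX μ P hx hxμ hind
    hδ hδ1⟩
  rintro f ⟨Θ, hΘ, rfl⟩
  exact KLGen.integrable_klReg_network hd hw hα hα0 hρ hX μ hΘ
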